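/- Let $M$ be a smooth oriented $4$-manifold with a smooth Lorentzian metric $g$ of signature $(+,-,-,-)$ and volume form $\varepsilon$. Let $F$ be a nowhere vanishing smooth solution of the source-free Maxwell equations $dF=0$, $d(\star F)=0$, where $\star F_{ab}=\tfrac12\varepsilon_{abcd}F^{cd}$, and assume that $F$ is simple, i.e. at each point a wedge product of two covectors. Let $\mathcal F_1$ and $\mathcal F_2$ be the dual foliations induced by $F$ and $\star F$, i.e. the two-dimensional smooth foliations of $M$ whose leaves are everywhere tangent to $\ker F$ and to $\ker\star F$, respectively. Let $v$ be a Gaussian observer field, i.e. a smooth vector field with $v_av^a=1$ and $v_{[a}\nabla_b v_{c]}=0$, and let $E^a=F^a{}_b v^b$ and $B^a=-\star F^a{}_b v^b$ be the electric and magnetic fields measured by $v$. Let $\Sigma$ be a spacelike hypersurface (an injectively immersed three-dimensional submanifold) orthogonal to $v$. For $i=1,2$, say that $\mathcal F_i$ is transversal to $\Sigma$ at $q\in\Sigma$ if $T_q\mathcal F_i+T_q\Sigma=T_qM$, and let the transversal intersection $\mathcal F_i\pitchfork\Sigma$ be the family of the connected components, over all leaves $L$ of $\mathcal F_i$, of the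 set of points of $L\cap\Sigma$ at which $\mathcal F_i$ is transversal to $\Sigma$ (components with respect to the manifold topology of that intersection). Let a line of force of $B$ (or of $E$) in $\Sigma$ be the image of a maximal integral curve in $\Sigma$ of that vector field along which it does not vanish. Then: 1. the family of lines of force of $B$ in $\Sigma$ is equal to $\mathcal F_1\pitchfork\Sigma$; 2. the family of lines of force of $E$ in $\Sigma$ is equal to $\mathcal F_2\pitchfork\Sigma$; 3. through a point $q\in\Sigma$ there passes a line of force of $B$ if and only if $\mathcal F_1$ is transversal to $\Sigma$ at $q$, and a line of force of $E$ if and only if $\mathcal F_2$ is transversal to $\Sigma$ at $q$. -/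

import Mathlib

open scoped Manifold ContDiff Topology
open Set

noncomputable section

namespace FieldSheets

/-! ### Foliations -/

section Foliation

variable {m : ℕ} {M : Type*} [TopologicalSpace M] [ChartedSpace (EuclideanSpace ℝ (Fin m)) M]

/-- A chart `φ` is distinguished by a decomposition `leaves` of `M`, with leaves of dimension `k`,
if the connected components of the trace of each leaf on the domain of `φ` (the plaques) are the
sets on which the last `m - k` coordinates are prescribed constants. -/
def IsDistinguished (k : ℕ) (leaves : Set (Set M))
    (φ : OpenPartialHomeomorph M (EuclideanSpace ℝ (Fin m))) : Prop :=
  ∀ L ∈ leaves, ∀ q ∈ L ∩ φ.source,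
    connectedComponentIn (L ∩ φ.source) q =
      {x | x ∈ φ.source ∧ ∀ i : Fin m, k ≤ (i : ℕ) → φ x i = φ q i}

variable (m M) in
/-- A smooth `k`-dimensional foliation of the `m`-dimensional manifold `M`: a decomposition into
disjoint connected leaves with smooth distinguished charts around every point.

Because the plaques are the connected components (for the topology of `M`) of the traces of a leaf,
a path of `M` whose image lies in a leaf is locally contained in plaques; thus path-connectedness in
`M` expresses that a leaf is connected for its own `k`-dimensional manifold topology. -/
structure Foliation (k : ℕ) where
  /-- the set of all leaves -/
  leaves : Set (Set M)
  isPartition : Setoid.IsPartition leaves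
  isPathConnected : ∀ L ∈ leaves, IsPathConnected L
  exists_chart : ∀ p : M, ∃ φ ∈ IsManifold.maximalAtlas (𝓡 m) ∞ M,
    p ∈ φ.source ∧ IsDistinguished k leaves φ

/-- The tangent space at `p` of the leaf through `p`: the vectors annihilated by the differentials
of the last `m - k` coordinates of the distinguished charts (every distinguished chart around `p`
gives the same space). -/
def Foliation.tangentSpace {k : ℕ} (𝓕 : Foliation m M k) (p : M) :
    Submodule ℝ (TangentSpace (𝓡 m) p) where
  carrier := {w | ∀ φ ∈ IsManifold.maximalAtlas (𝓡 m) ∞ M, p ∈ φ.source →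
    IsDistinguished k 𝓕.leaves φ → ∀ i : Fin m, k ≤ (i : ℕ) →
      (show EuclideanSpace ℝ (Fin m) from mfderiv (𝓡 m) (𝓡 m) φ p w) i = 0}
  zero_mem' := fun φ _ _ _ i _ => by
    rw [map_zero]; rfl
  add_mem' := fun {a b} ha hb φ h1 h2 h3 i hi => by
    have h := congrArg₂ (fun x y : ℝ => x + y) (ha φ h1 h2 h3 i hi) (hb φ h1 h2 h3 i hi)
    rw [map_add]
    exact h.trans (add_zero 0)
  smul_mem' := fun c a ha φ h1 h2 h3 i hi => by
    have h := congrArg (fun x : ℝ => c * x) (ha φ h1 h2 h3 i hi)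
    rw [map_smul]
    exact h.trans (mul_zero c)

variable (d : ℕ) {N : Type*} [TopologicalSpace N] [ChartedSpace (EuclideanSpace ℝ (Fin d)) N]

/-- The tangent space of the immersed submanifold `ι : N → M` at `q`, as a subspace of the tangent
space of `M`. -/
def immersedTangentSpace (ι : N → M) (q : N) : Submodule ℝ (TangentSpace (𝓡 m) (ι q)) :=
  LinearMap.range (mfderiv (𝓡 d) (𝓡 m) ι q).toLinearMap

/-- The foliation `𝓕` is transversal to the immersed submanifold `ι : N → M` at `q`: the tangent
space of the leaf and that of the submanifold together span the tangent space of `M`. -/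
def Foliation.IsTransversalAt {k : ℕ} (𝓕 : Foliation m M k) (ι : N → M) (q : N) : Prop :=
  𝓕.tangentSpace (ι q) ⊔ immersedTangentSpace d ι q = ⊤

/-- The transversal intersection of the foliation `𝓕` with the immersed submanifold `ι : N → M`, as
a family of subsets of `N`: the components of the sets of points of `N` that lie on a given leaf and
at which the submanifold is transversal to `𝓕`. Path components are components for the manifold
topology of the intersection of leaf and submanifold (a leaf may be dense in `M`). -/
def Foliation.transversalIntersection {k : ℕ} (𝓕 : Foliation m M k) (ι : N → M) : Set (Set N) :=
  {C | ∃ L ∈ 𝓕.leaves, ∃ q : N, ι q ∈ L ∧ 𝓕.IsTransversalAt d ι q ∧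
    C = pathComponentIn {q' : N | ι q' ∈ L ∧ 𝓕.IsTransversalAt d ι q'} q}

/-- `γ : J → N` is an integral curve of the vector field `X` of `M` that lies in the immersed
submanifold `ι : N → M`; `J` is an open interval. -/
def IsIntegralCurveIn (X : (p : M) → TangentSpace (𝓡 m) p) (ι : N → M) (J : Set ℝ) (γ : ℝ → N) :
    Prop :=
  IsOpen J ∧ J.OrdConnected ∧ ContinuousOn γ J ∧ IsMIntegralCurveOn (I := 𝓡 m) (ι ∘ γ) X J

/-- `C` is a line of force of `X` in the immersed submanifold `ι : N → M`: the image of a maximal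
integral curve of `X` in the submanifold that does not degenerate to a zero of `X`. -/
def IsLineOfForce (X : (p : M) → TangentSpace (𝓡 m) p) (ι : N → M) (C : Set N) : Prop :=
  ∃ (J : Set ℝ) (γ : ℝ → N), J.Nonempty ∧ IsIntegralCurveIn X ι J γ ∧
    (∀ (J' : Set ℝ) (γ' : ℝ → N), J ⊆ J' → EqOn γ γ' J → IsIntegralCurveIn X ι J' γ' → J' = J) ∧
    (∀ t ∈ J, X (ι (γ t)) ≠ 0) ∧ C = γ '' J

end Foliation

/-! ### Differential forms -/

section Forms

variable {m : ℕ} (M : Type*) [TopologicalSpace M] [ChartedSpace (EuclideanSpace ℝ (Fin m)) M]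

/-- Differential `n`-forms, as families of alternating forms on the tangent spaces. -/
abbrev DiffForm (m : ℕ) (M : Type*) [TopologicalSpace M]
    [ChartedSpace (EuclideanSpace ℝ (Fin m)) M] (n : ℕ) :=
  (p : M) → (TangentSpace (𝓡 m) p) [⋀^Fin n]→L[ℝ] ℝ

variable {M} {n : ℕ}

/-- The expression of a form in the preferred chart at `p₀`: its pullback by the inverse chart. -/
def DiffForm.inChart (σ : DiffForm m M n) (p₀ : M) (y : EuclideanSpace ℝ (Fin m)) :
    (EuclideanSpace ℝ (Fin m)) [⋀^Fin n]→L[ℝ] ℝ :=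
  (σ ((extChartAt (𝓡 m) p₀).symm y)).compContinuousLinearMap
    (mfderiv 𝓘(ℝ, EuclideanSpace ℝ (Fin m)) (𝓡 m) (extChartAt (𝓡 m) p₀).symm y)

/-- A form is smooth if all its chart expressions are. -/
def DiffForm.IsSmooth (σ : DiffForm m M n) : Prop :=
  ∀ p₀ : M, ContDiffOn ℝ ∞ (DiffForm.inChart σ p₀) (extChartAt (𝓡 m) p₀).target

/-- A closed form: a smooth form such that the exterior derivatives of its chart expressions
vanish. -/
def DiffForm.IsClosed (σ : DiffForm m M n) : Prop :=
  DiffForm.IsSmooth σ ∧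
    ∀ p₀ : M, ∀ y ∈ (extChartAt (𝓡 m) p₀).target, extDeriv (DiffForm.inChart σ p₀) y = 0

/-- A 2-form is simple if it is at each point the wedge product of two covectors. -/
def DiffForm.IsSimple (σ : DiffForm m M 2) : Prop :=
  ∀ p : M, ∃ α β : TangentSpace (𝓡 m) p →L[ℝ] ℝ, ∀ u w : TangentSpace (𝓡 m) p,
    σ p ![u, w] = α u * β w - α w * β u

/-- The foliation `𝓕` is induced by the 2-form `σ`: its leaves are everywhere tangent to the kernel
of `σ`. -/
def Foliation.IsInducedBy {k : ℕ} (𝓕 : Foliation m M k) (σ : DiffForm m M 2) : Prop :=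
  ∀ (p : M) (u : TangentSpace (𝓡 m) p),
    u ∈ 𝓕.tangentSpace p ↔ ∀ w : TangentSpace (𝓡 m) p, σ p ![u, w] = 0

end Forms

/-! ### Spacetime -/

section Spacetime

variable (M : Type*) [TopologicalSpace M] [ChartedSpace (EuclideanSpace ℝ (Fin 4)) M]

/-- The signs of the diagonal of a metric of signature `(+,-,-,-)`. -/
def η : Fin 4 → ℝ := ![1, -1, -1, -1]

/-- A smooth metric of signature `(+,-,-,-)` on a manifold of dimension four. -/
structure LorentzMetric [IsManifold (𝓡 4) ∞ M] where
  /-- the scalar product on each tangent space -/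
  val (p : M) : TangentSpace (𝓡 4) p →L[ℝ] TangentSpace (𝓡 4) p →L[ℝ] ℝ
  symm (p : M) (u w : TangentSpace (𝓡 4) p) : val p u w = val p w u
  exists_frame (p : M) : ∃ e : Module.Basis (Fin 4) ℝ (TangentSpace (𝓡 4) p),
    ∀ i j, val p (e i) (e j) = if i = j then η i else 0
  contMDiff : ContMDiff (𝓡 4) ((𝓡 4).prod 𝓘(ℝ, EuclideanSpace ℝ (Fin 4) →L[ℝ]
      EuclideanSpace ℝ (Fin 4) →L[ℝ] ℝ)) ∞
    (fun p ↦ Bundle.TotalSpace.mk' (EuclideanSpace ℝ (Fin 4) →L[ℝ]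
      EuclideanSpace ℝ (Fin 4) →L[ℝ] ℝ) p (val p))

variable {M} [IsManifold (𝓡 4) ∞ M]

namespace LorentzMetric

variable (g : LorentzMetric M)

/-- An orthonormal frame of the tangent space at `p`. What is built from it below does not depend on
the choice: the frame only enters through the inverse metric `∑ η_c e_c ⊗ e_c`. -/
def frame (p : M) : Module.Basis (Fin 4) ℝ (TangentSpace (𝓡 4) p) :=
  (g.exists_frame p).choose

lemma val_frame (p : M) (i j : Fin 4) :
    g.val p (g.frame p i) (g.frame p j) = if i = j then η i else 0 :=
  (g.exists_frame p).choose_spec i j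

/-- Raising the index of a covector. -/
def sharp (p : M) (α : TangentSpace (𝓡 4) p → ℝ) : TangentSpace (𝓡 4) p :=
  ∑ c, (η c * α (g.frame p c)) • g.frame p c

/-- The vector `α♯` is characterized by `g(α♯, w) = α(w)`. -/
lemma val_sharp (p : M) (α : TangentSpace (𝓡 4) p →ₗ[ℝ] ℝ) (w : TangentSpace (𝓡 4) p) :
    g.val p (g.sharp p α) w = α w := by
  have hη : ∀ i, η i * η i = 1 := by
    intro i; fin_cases i <;> simp [η]
  have key : ((g.val p (g.sharp p α)).toLinearMap : TangentSpace (𝓡 4) p →ₗ[ℝ] ℝ) = α := by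
    refine (g.frame p).ext fun j => ?_
    have h : g.val p (g.sharp p α) (g.frame p j)
        = ∑ c, (η c * α (g.frame p c)) * g.val p (g.frame p c) (g.frame p j) := by
      simp [sharp]
    refine h.trans ?_
    simp only [g.val_frame, mul_ite, mul_zero, Finset.sum_ite_eq', Finset.mem_univ, if_true]
    linear_combination α (g.frame p j) * hη j
  exact LinearMap.congr_fun key w

/-- `ε` is the volume form of `g` for one of the orientations of `M`: a smooth 4-form that takes the
values `1` or `-1` on all orthonormal frames. -/
structure IsVolumeForm (ε : DiffForm 4 M 4) : Prop where
  isSmooth : DiffForm.IsSmooth ε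
  normalized : ∀ (p : M) (e : Module.Basis (Fin 4) ℝ (TangentSpace (𝓡 4) p)),
    (∀ i j, g.val p (e i) (e j) = if i = j then η i else 0) → ε p e = 1 ∨ ε p e = -1

/-- The dual `(⋆F)_{ab} = (1/2) ε_{abcd} F^{cd}` of a 2-form, with `F^{cd} = η_c η_d F_{cd}` in an
orthonormal frame (and `ε_{cdab} = ε_{abcd}`). -/
def hodgeStar (ε : DiffForm 4 M 4) (F : DiffForm 4 M 2) : DiffForm 4 M 2 := fun p =>
  (1 / 2 : ℝ) • ∑ c, ∑ d, (η c * η d * F p ![g.frame p c, g.frame p d]) •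
    (ContinuousAlternatingMap.curryLeft (E := EuclideanSpace ℝ (Fin 4))
      (ContinuousAlternatingMap.curryLeft (E := EuclideanSpace ℝ (Fin 4)) (ε p)
        (g.frame p c)) (g.frame p d))

lemma hodgeStar_apply (ε : DiffForm 4 M 4) (F : DiffForm 4 M 2) (p : M)
    (u w : TangentSpace (𝓡 4) p) :
    g.hodgeStar ε F p ![u, w] = (1 / 2 : ℝ) * ∑ c, ∑ d,
      η c * η d * F p ![g.frame p c, g.frame p d] *
        ε p ![g.frame p c, g.frame p d, u, w] := by
  have h : ∀ (a : (EuclideanSpace ℝ (Fin 4)) [⋀^Fin 4]→L[ℝ] ℝ) (r : Fin 4 → Fin 4 → ℝ)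
      (e : Fin 4 → EuclideanSpace ℝ (Fin 4)) (x y : EuclideanSpace ℝ (Fin 4)),
      ((1 / 2 : ℝ) • ∑ c, ∑ d, r c d • (a.curryLeft (e c)).curryLeft (e d)) ![x, y] =
        (1 / 2 : ℝ) * ∑ c, ∑ d, r c d * a ![e c, e d, x, y] := by
    intro a r e x y
    simp
  exact h (ε p) (fun c d => η c * η d * F p ![g.frame p c, g.frame p d]) (g.frame p) u w

/-- The electric field `E^a = F^a_b v^b` measured by `v`. -/
def electricField (F : DiffForm 4 M 2) (v : (p : M) → TangentSpace (𝓡 4) p) (p : M) :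
    TangentSpace (𝓡 4) p :=
  g.sharp p fun w => F p ![w, v p]

/-- The magnetic field `B^a = -⋆F^a_b v^b` measured by `v`. -/
def magneticField (ε : DiffForm 4 M 4) (F : DiffForm 4 M 2)
    (v : (p : M) → TangentSpace (𝓡 4) p) (p : M) : TangentSpace (𝓡 4) p :=
  g.sharp p fun w => -(g.hodgeStar ε F p ![w, v p])

/-- A non-vanishing simple smooth solution of the source-free Maxwell equations. -/
structure IsSimpleMaxwellField (ε : DiffForm 4 M 4) (F : DiffForm 4 M 2) : Prop where
  ne_zero : ∀ p, F p ≠ 0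
  isSimple : DiffForm.IsSimple F
  isClosed : DiffForm.IsClosed F
  isClosed_hodgeStar : DiffForm.IsClosed (g.hodgeStar ε F)

/-- An observer field: a smooth field of unit timelike vectors. -/
structure IsObserver (v : (p : M) → TangentSpace (𝓡 4) p) : Prop where
  contMDiff : ContMDiff (𝓡 4) (𝓡 4).tangent ∞ (fun p ↦ (⟨p, v p⟩ : TangentBundle (𝓡 4) M))
  unit : ∀ p, g.val p (v p) (v p) = 1

/-- The covector field `v_a` in the preferred chart at `p₀`. -/
def flatInChart (v : (p : M) → TangentSpace (𝓡 4) p) (p₀ : M) (y : EuclideanSpace ℝ (Fin 4)) :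
    EuclideanSpace ℝ (Fin 4) →L[ℝ] ℝ :=
  (g.val _ (v ((extChartAt (𝓡 4) p₀).symm y))).comp
    (mfderiv 𝓘(ℝ, EuclideanSpace ℝ (Fin 4)) (𝓡 4) (extChartAt (𝓡 4) p₀).symm y)

/-- The field `v` is Gaussian, that is `v_{[a} ∇_b v_{c]} = 0`. As the Levi-Civita connection has no
torsion, this is `v_{[a} ∂_b v_{c]} = 0` in charts. -/
def IsGaussian (v : (p : M) → TangentSpace (𝓡 4) p) : Prop :=
  ∀ p₀ : M, ∀ y ∈ (extChartAt (𝓡 4) p₀).target, ∀ a b c : EuclideanSpace ℝ (Fin 4),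
    let θ := g.flatInChart v p₀
    let dθ := fun x z : EuclideanSpace ℝ (Fin 4) => fderiv ℝ θ y x z - fderiv ℝ θ y z x
    θ y a * dθ b c + θ y b * dθ c a + θ y c * dθ a b = 0

variable {N : Type*} [TopologicalSpace N] [ChartedSpace (EuclideanSpace ℝ (Fin 3)) N]

/-- `ι : N → M` is a spacelike hypersurface: an injective immersion of a manifold of dimension
three, whose nonzero tangent vectors are spacelike. -/
structure IsSpacelikeHypersurface (ι : N → M) : Prop where
  injective : Function.Injective ι
  isImmersion : Manifold.IsImmersion (𝓡 3) (𝓡 4) ∞ ι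
  spacelike : ∀ q, ∀ w ∈ immersedTangentSpace 3 ι q, w ≠ 0 → g.val (ι q) w w < 0

/-- The hypersurface `ι : N → M` is orthogonal to the vector field `v`. -/
def IsOrthogonal (ι : N → M) (v : (p : M) → TangentSpace (𝓡 4) p) : Prop :=
  ∀ q, ∀ w ∈ immersedTangentSpace 3 ι q, g.val (ι q) (v (ι q)) w = 0

end LorentzMetric

end Spacetime

end FieldSheets

end

open scoped Manifold ContDiff Topology
open Set

noncomputable section

/-! The pointwise part is linear algebra. A nonzero simple $F$ is $a^\flat\wedge b^\flat$ with $a,b$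
independent, and then $\star F=\varepsilon(a,b,\cdot,\cdot)$ (`exists_isBivectorPair`). Hence $\ker
F=\{a,b\}^\perp$ and $\ker\star F=\mathrm{span}(a,b)$. From $g(B,w)=-\star F(w,v)$ and
$g(E,w)=F(w,v)$ it follows that $B\in\ker F$, $E\in\ker\star F$, and that both are orthogonal to
$v$, hence tangent to $\Sigma$, since $T\Sigma=v^\perp$. Moreover $B=0$ iff
$v\in\mathrm{span}(a,b)$, i.e. iff $v\perp\ker F$, and $E=0$ iff $v\perp\mathrm{span}(a,b)=\ker\star
F$. So each field vanishes exactly where its foliation fails to be transversal to $\Sigma$.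

What remains holds for any such field (`IsIntersectionField`) when $k+d=m+1$: at transversal points
the tangent spaces of leaf and submanifold meet in a line, spanned by the field. An integral curve
stays in one leaf, and if it is nonzero once it never vanishes, so it lies in one component of the
transversal intersection. Conversely, near a transversal point the plaque meets the submanifold in a
level set of a map whose differential has a one-dimensional kernel, and the integral curve covers
that level set (`level_set_subset_curve`, `eventually_mem_image`). A path in a component therefore
has a clopen set of times on a given maximal integral curve, and never leaves it
(`image_eq_pathComponentIn`). -/

namespace FieldSheets

set_option linter.unusedSectionVars false

/-! ### Maximal integral curves on a boundaryless Hausdorff manifold -/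

section IntegralCurves

variable {E H N : Type*} [NormedAddCommGroup E] [NormedSpace ℝ E] [TopologicalSpace H]
  {I : ModelWithCorners ℝ E H} [TopologicalSpace N] [ChartedSpace H N] [IsManifold I 1 N]

/-- `γ` is an integral curve of `Y` on the open interval `J`. -/
structure IsOpenIntegralCurve (Y : (q : N) → TangentSpace I q) (J : Set ℝ) (γ : ℝ → N) :
    Prop where
  isOpen : IsOpen J
  ordConnected : J.OrdConnected
  isMIntegralCurveOn : IsMIntegralCurveOn (I := I) γ Y J

/-- `γ` on `J` is a maximal integral curve of `Y`. -/
def IsMaximalIntegralCurve (Y : (q : N) → TangentSpace I q) (J : Set ℝ) (γ : ℝ → N) : Prop :=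
  IsOpenIntegralCurve Y J γ ∧
    ∀ J' γ', J ⊆ J' → EqOn γ γ' J → IsOpenIntegralCurve Y J' γ' → J' = J

variable {Y : (q : N) → TangentSpace I q} {J J' : Set ℝ} {γ γ' : ℝ → N} {t₀ : ℝ}

lemma IsOpenIntegralCurve.mono (h : IsOpenIntegralCurve Y J γ) (hJ' : IsOpen J')
    (hc : J'.OrdConnected) (hs : J' ⊆ J) : IsOpenIntegralCurve Y J' γ :=
  ⟨hJ', hc, h.isMIntegralCurveOn.mono hs⟩

lemma IsOpenIntegralCurve.comp_sub (h : IsOpenIntegralCurve Y J γ) (a : ℝ) :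
    IsOpenIntegralCurve Y {t | t - a ∈ J} (fun t => γ (t - a)) := by
  refine ⟨h.isOpen.preimage (continuous_id.sub continuous_const), ⟨fun x hx y hy z hz => ?_⟩, ?_⟩
  · exact h.ordConnected.out hx hy ⟨sub_le_sub_right hz.1 a, sub_le_sub_right hz.2 a⟩
  · exact (isMIntegralCurveOn_comp_sub (dt := a)).2 h.isMIntegralCurveOn

/-- The interval may be unbounded, while the uniqueness theorem invoked in
`IsOpenIntegralCurve.eqOn` is stated on `Ioo a b`. -/
lemma exists_Ioo_subset (hJ : IsOpen J) (hc : J.OrdConnected) {s t : ℝ} (hs : s ∈ J) (ht : t ∈ J) :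
    ∃ a b, s ∈ Ioo a b ∧ t ∈ Ioo a b ∧ Ioo a b ⊆ J := by
  have key : ∀ u ∈ J, ∃ a b, u ∈ Ioo a b ∧ a ∈ J ∧ b ∈ J := by
    intro u hu
    obtain ⟨r, hr, hb⟩ := Metric.isOpen_iff.1 hJ u hu
    refine ⟨u - r / 2, u + r / 2, ⟨by linarith, by linarith⟩, hb ?_, hb ?_⟩ <;>
      simp [abs_of_pos, hr]
  obtain ⟨a, b, h1, ha, hb⟩ := key s hs
  obtain ⟨a', b', h1', ha', hb'⟩ := key t ht
  refine ⟨min a a', max b b', ⟨min_lt_of_left_lt h1.1, lt_max_of_lt_left h1.2⟩,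
    ⟨min_lt_of_right_lt h1'.1, lt_max_of_lt_right h1'.2⟩, fun x hx => hc.out ?_ ?_
      ⟨hx.1.le, hx.2.le⟩⟩
  · rcases min_choice a a' with h | h <;> rw [h] <;> assumption
  · rcases max_choice b b' with h | h <;> rw [h] <;> assumption

variable [BoundarylessManifold I N] [T2Space N] [CompleteSpace E]

lemma IsOpenIntegralCurve.eqOn
    (hY : ContMDiff I I.tangent 1 (fun q => (⟨q, Y q⟩ : TangentBundle I N)))
    (h : IsOpenIntegralCurve Y J γ) (h' : IsOpenIntegralCurve Y J γ') (ht₀ : t₀ ∈ J)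
    (heq : γ t₀ = γ' t₀) : EqOn γ γ' J := by
  intro t ht
  obtain ⟨a, b, h1, h2, hs⟩ := exists_Ioo_subset h.isOpen h.ordConnected ht₀ ht
  exact isMIntegralCurveOn_Ioo_eqOn_of_contMDiff_boundaryless h1 hY
    (h.isMIntegralCurveOn.mono hs) (h'.isMIntegralCurveOn.mono hs) heq h2

lemma exists_isOpenIntegralCurve
    (hY : ContMDiff I I.tangent 1 (fun q => (⟨q, Y q⟩ : TangentBundle I N))) (q : N) (t₀ : ℝ) :
    ∃ J γ, IsOpenIntegralCurve Y J γ ∧ t₀ ∈ J ∧ γ t₀ = q := by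
  obtain ⟨γ, h0, hγ⟩ := exists_isMIntegralCurveAt_of_contMDiffAt_boundaryless (t₀ := t₀)
    (hY.contMDiffAt (x := q))
  obtain ⟨r, hr, hγ⟩ := isMIntegralCurveAt_iff'.1 hγ
  exact ⟨Metric.ball t₀ r, γ, ⟨Metric.isOpen_ball, (convex_ball t₀ r).ordConnected, hγ⟩,
    Metric.mem_ball_self hr, h0⟩

/-- The largest integral curve with a given value at a given time. -/
lemma exists_greatest_integralCurve
    (hY : ContMDiff I I.tangent 1 (fun q => (⟨q, Y q⟩ : TangentBundle I N))) (q : N) (t₀ : ℝ) :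
    ∃ J γ, IsOpenIntegralCurve Y J γ ∧ t₀ ∈ J ∧ γ t₀ = q ∧
      ∀ J' γ', IsOpenIntegralCurve Y J' γ' → t₀ ∈ J' → γ' t₀ = q → J' ⊆ J ∧ EqOn γ' γ J' := by
  classical
  set 𝒞 : Set (Set ℝ × (ℝ → N)) := {c | IsOpenIntegralCurve Y c.1 c.2 ∧ t₀ ∈ c.1 ∧ c.2 t₀ = q}
    with h𝒞
  have hex : ∀ t, ∃ σ : ℝ → N, t ∈ ⋃ c ∈ 𝒞, c.1 → ∃ J, (J, σ) ∈ 𝒞 ∧ t ∈ J := by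
    intro t
    by_cases ht : t ∈ ⋃ c ∈ 𝒞, c.1
    · simp only [mem_iUnion] at ht
      obtain ⟨c, hc, htc⟩ := ht
      exact ⟨c.2, fun _ => ⟨c.1, hc, htc⟩⟩
    · exact ⟨fun _ => q, fun h => absurd h ht⟩
  choose σ hσ using hex
  -- By uniqueness on the overlap of the domains, the curve chosen for each time does not matter, so
  -- the diagonal `σ t t` extends every member of `𝒞`.
  have heq : ∀ c ∈ 𝒞, EqOn c.2 (fun t => σ t t) c.1 := by
    intro c hc t ht
    obtain ⟨J, hJ, htJ⟩ := hσ t (mem_iUnion₂.2 ⟨c, hc, ht⟩)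
    have hop := hc.1.isOpen.inter hJ.1.isOpen
    have hoc := hc.1.ordConnected.inter hJ.1.ordConnected
    exact (hc.1.mono hop hoc inter_subset_left).eqOn hY (hJ.1.mono hop hoc inter_subset_right)
      ⟨hc.2.1, hJ.2.1⟩ (hc.2.2.trans hJ.2.2.symm) ⟨ht, htJ⟩
  obtain ⟨J₁, γ₁, h₁, ht₁, hq₁⟩ := exists_isOpenIntegralCurve hY q t₀
  have hm₁ : (J₁, γ₁) ∈ 𝒞 := ⟨h₁, ht₁, hq₁⟩
  refine ⟨⋃ c ∈ 𝒞, c.1, fun t => σ t t, ⟨isOpen_biUnion fun c hc => hc.1.isOpen, ?_, ?_⟩,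
    mem_iUnion₂.2 ⟨_, hm₁, ht₁⟩, (heq _ hm₁ ht₁).symm.trans hq₁, ?_⟩
  · refine IsPreconnected.ordConnected ?_
    rw [biUnion_eq_iUnion]
    exact isPreconnected_iUnion ⟨t₀, mem_iInter.2 fun c => c.2.2.1⟩
      fun c => c.2.1.ordConnected.isPreconnected
  · refine IsMIntegralCurveAt.isMIntegralCurveOn fun t ht => ?_
    obtain ⟨c, hc, htc⟩ := mem_iUnion₂.1 ht
    have h := hc.1.isMIntegralCurveOn.isMIntegralCurveAt (hc.1.isOpen.mem_nhds htc)
    have hev : ∀ᶠ s in 𝓝 t, c.2 =ᶠ[𝓝 s] fun t => σ t t := by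
      filter_upwards [hc.1.isOpen.mem_nhds htc] with s hs
      filter_upwards [hc.1.isOpen.mem_nhds hs] with u hu using heq c hc hu
    filter_upwards [h, hev] with s hs hs'
    have := hs.congr_of_eventuallyEq hs'.symm
    rwa [hs'.self_of_nhds] at this
  · intro J' γ' h' ht' hq'
    have hm : (J', γ') ∈ 𝒞 := ⟨h', ht', hq'⟩
    exact ⟨fun t ht => mem_iUnion₂.2 ⟨_, hm, ht⟩, heq _ hm⟩

lemma exists_isMaximalIntegralCurve
    (hY : ContMDiff I I.tangent 1 (fun q => (⟨q, Y q⟩ : TangentBundle I N))) (q : N) (t₀ : ℝ) :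
    ∃ J γ, IsMaximalIntegralCurve Y J γ ∧ t₀ ∈ J ∧ γ t₀ = q := by
  obtain ⟨J, γ, h, ht, hq, hmax⟩ := exists_greatest_integralCurve hY q t₀
  exact ⟨J, γ, ⟨h, fun J' γ' hs heq h' =>
    ((hmax J' γ' h' (hs ht) ((heq ht).symm.trans hq)).1).antisymm hs⟩, ht, hq⟩

/-- An integral curve that meets a maximal one is contained in it. -/
lemma IsMaximalIntegralCurve.image_subset
    (hY : ContMDiff I I.tangent 1 (fun q => (⟨q, Y q⟩ : TangentBundle I N)))
    (h : IsMaximalIntegralCurve Y J γ) (h' : IsOpenIntegralCurve Y J' γ') {s t : ℝ} (hs : s ∈ J)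
    (ht : t ∈ J') (heq : γ' t = γ s) : γ' '' J' ⊆ γ '' J := by
  -- Both curves are compared with the greatest one through the common point; maximality forces its
  -- domain to be `J`. Shifting time by `s - t` makes `γ'` pass through that point at time `s`.
  obtain ⟨K, σ, hK, -, -, hmax⟩ := exists_greatest_integralCurve hY (γ s) s
  obtain ⟨h1, h2⟩ := hmax J γ h.1 hs rfl
  have hKJ : K = J := h.2 K σ h1 h2 hK
  obtain ⟨h3, h4⟩ := hmax _ _ (h'.comp_sub (s - t)) (by simpa using ht) (by simpa using heq)
  rintro _ ⟨u, hu, rfl⟩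
  have hu' : u + (s - t) ∈ {x | x - (s - t) ∈ J'} := by simpa using hu
  refine ⟨u + (s - t), hKJ ▸ h3 hu', ?_⟩
  have e1 := h4 hu'
  have e2 := h2 (hKJ ▸ h3 hu')
  rw [e2, ← e1]
  simp

/-- At a zero of the field the constant curve is an integral curve, so uniqueness would make the
whole curve constant there. -/
lemma IsOpenIntegralCurve.ne_zero
    (hY : ContMDiff I I.tangent 1 (fun q => (⟨q, Y q⟩ : TangentBundle I N)))
    (h : IsOpenIntegralCurve Y J γ) {s t : ℝ} (hs : s ∈ J) (ht : t ∈ J) (hne : Y (γ s) ≠ 0) :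
    Y (γ t) ≠ 0 := by
  intro h0
  have hc : IsOpenIntegralCurve Y J (fun _ => γ t) :=
    ⟨h.isOpen, h.ordConnected, (isMIntegralCurve_const h0).isMIntegralCurveOn J⟩
  have := h.eqOn hY hc ht rfl hs
  rw [this] at hne
  exact hne h0

end IntegralCurves

/-! ### Vector fields and integral curves on immersed submanifolds -/

section Immersion

variable {E H N E' H' M : Type*} [NormedAddCommGroup E] [NormedSpace ℝ E] [TopologicalSpace H]
  {I : ModelWithCorners ℝ E H} [TopologicalSpace N] [ChartedSpace H N]
  [NormedAddCommGroup E'] [NormedSpace ℝ E'] [TopologicalSpace H']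
  {I' : ModelWithCorners ℝ E' H'} [TopologicalSpace M] [ChartedSpace H' M]
  [I.Boundaryless] [IsManifold I ∞ N] [IsManifold I' ∞ M] {ι : N → M}

/-- In adapted charts the immersion is `x ↦ A (x, 0)`; going back through the chart of `M`,
`A.symm`, the first projection and the inverse chart of `N` undoes it. -/
lemma exists_local_leftInverse_of_complement {F : Type*} [NormedAddCommGroup F] [NormedSpace ℝ F]
    {q : N} (h : Manifold.IsImmersionAtOfComplement F I I' ∞ ι q) :
    ∃ ρ : M → N, ContMDiffAt I' I ∞ ρ (ι q) ∧ ∀ᶠ y in 𝓝 q, ρ (ι y) = y := by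
  obtain ⟨φ, ψ, A, hφ, hψ, hq, hq', hw⟩ : ∃ (φ : OpenPartialHomeomorph N H)
      (ψ : OpenPartialHomeomorph M H') (A : (E × F) ≃L[ℝ] E'),
      φ ∈ IsManifold.maximalAtlas I ∞ N ∧ ψ ∈ IsManifold.maximalAtlas I' ∞ M ∧
      q ∈ φ.source ∧ ι q ∈ ψ.source ∧
      EqOn (ψ.extend I' ∘ ι ∘ (φ.extend I).symm) (A ∘ fun x => (x, 0)) (φ.extend I).target :=
    ⟨h.domChart, h.codChart, h.equiv, h.domChart_mem_maximalAtlas, h.codChart_mem_maximalAtlas,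
      h.mem_domChart_source, h.mem_codChart_source, h.writtenInCharts⟩
  have hsrc : ∀ y ∈ φ.source, y ∈ (φ.extend I).source := fun y hy => by
    rw [OpenPartialHomeomorph.extend_source]; exact hy
  have hev : ∀ y ∈ φ.source, (A.symm (ψ.extend I' (ι y))).1 = φ.extend I y := by
    intro y hy
    have hy' := hw ((φ.extend I).map_source (hsrc y hy))
    rw [Function.comp_apply, Function.comp_apply, (φ.extend I).left_inv (hsrc y hy)] at hy'
    rw [hy', Function.comp_apply, ContinuousLinearEquiv.symm_apply_apply]
  refine ⟨fun p => (φ.extend I).symm (A.symm (ψ.extend I' p)).1, ?_, ?_⟩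
  · have h1 : ContMDiffAt I' 𝓘(ℝ, E') ∞ (ψ.extend I') (ι q) :=
      OpenPartialHomeomorph.contMDiffAt_extend hψ hq'
    have h2 : ContMDiff 𝓘(ℝ, E') 𝓘(ℝ, E) ∞ (fun x => (A.symm x).1) :=
      (contDiff_fst.comp A.symm.contDiff).contMDiff
    have h3 : ContMDiffAt 𝓘(ℝ, E) I ∞ (φ.extend I).symm (A.symm (ψ.extend I' (ι q))).1 := by
      rw [hev q hq]
      have hm := contMDiffOn_extend_symm hφ
      rw [← OpenPartialHomeomorph.extend_target'] at hm
      exact hm.contMDiffAt (φ.isOpen_extend_target.mem_nhds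
        ((φ.extend I).map_source (hsrc q hq)))
    exact h3.comp (ι q) (h2.contMDiffAt.comp (ι q) h1)
  · filter_upwards [φ.open_source.mem_nhds hq] with y hy
    rw [hev y hy]
    exact (φ.extend I).left_inv (hsrc y hy)

/-- An immersion has local smooth left inverses. -/
lemma exists_local_leftInverse {q : N} (h : Manifold.IsImmersionAt I I' ∞ ι q) :
    ∃ ρ : M → N, ContMDiffAt I' I ∞ ρ (ι q) ∧ ∀ᶠ y in 𝓝 q, ρ (ι y) = y :=
  exists_local_leftInverse_of_complement h.isImmersionAtOfComplement_complement

/-- The left inverse is taken $C^2$ on an open set, so that its tangent map is $C^1$;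
differentiating `ρ ∘ ι = id` at nearby points makes `dρ` a left inverse of `dι`. -/
lemma exists_contMDiffOn_leftInverse (hι : Manifold.IsImmersion I I' ∞ ι) (q : N) :
    ∃ ρ : M → N, ∃ U : Set M, IsOpen U ∧ ContMDiffOn I' I 2 ρ U ∧ ∀ᶠ y in 𝓝 q,
      ι y ∈ U ∧ ρ (ι y) = y ∧ ∀ w : TangentSpace I y,
        (show E from mfderiv I' I ρ (ι y) (mfderiv I I' ι y w)) = w := by
  obtain ⟨ρ, hρ, hl⟩ := exists_local_leftInverse (hι.isImmersionAt q)
  have : IsManifold I 2 N := inferInstance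
  have : IsManifold I' 2 M := inferInstance
  obtain ⟨U₀, hU₀, hs⟩ := (contMDiffAt_iff_contMDiffOn_nhds (n := 2) (by decide)).1
    (hρ.of_le ENat.LEInfty.out)
  obtain ⟨U, hUU, hUo, hqU⟩ := mem_nhds_iff.1 hU₀
  refine ⟨ρ, U, hUo, hs.mono hUU, ?_⟩
  have hc : Continuous ι := hι.contMDiff.continuous
  filter_upwards [hc.continuousAt.preimage_mem_nhds (hUo.mem_nhds hqU), hl.eventually_nhds]
    with y hyU hy
  refine ⟨hyU, hy.self_of_nhds, fun w => ?_⟩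
  have h1 : MDifferentiableAt I' I ρ (ι y) :=
    (((hs.mono hUU).contMDiffAt (hUo.mem_nhds hyU)).mdifferentiableAt (by decide))
  have h2 : MDifferentiableAt I I' ι y := hι.contMDiff.mdifferentiableAt (by simp)
  have h3 : HasMFDerivAt I I (ρ ∘ ι) y (ContinuousLinearMap.id ℝ (TangentSpace I y)) :=
    (hasMFDerivAt_id y).congr_of_eventuallyEq (by simpa [Filter.EventuallyEq] using hy)
  have h4 := hasMFDerivAt_unique (h1.hasMFDerivAt.comp y h2.hasMFDerivAt) h3
  exact (congrArg (fun A : TangentSpace I y →L[ℝ] TangentSpace I y => A w) h4)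

lemma mfderiv_injective_of_isImmersion (hι : Manifold.IsImmersion I I' ∞ ι) (q : N) :
    Function.Injective (mfderiv I I' ι q) := by
  obtain ⟨ρ, U, -, -, h⟩ := exists_contMDiffOn_leftInverse hι q
  obtain ⟨-, -, h⟩ := h.self_of_nhds
  intro u w huw
  have := h u
  rw [huw] at this
  exact this.symm.trans (h w)

variable {X : (p : M) → TangentSpace I' p} {Y : (q : N) → TangentSpace I q}

/-- A smooth vector field tangent to an immersed submanifold restricts to a smooth vector field. -/
lemma contMDiff_of_mfderiv_eq (hι : Manifold.IsImmersion I I' ∞ ι)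
    (hX : ContMDiff I' I'.tangent 1 (fun p => (⟨p, X p⟩ : TangentBundle I' M)))
    (hYX : ∀ q, mfderiv I I' ι q (Y q) = X (ι q)) :
    ContMDiff I I.tangent 1 (fun q => (⟨q, Y q⟩ : TangentBundle I N)) := by
  have : IsManifold I 2 N := inferInstance
  have : IsManifold I' 2 M := inferInstance
  intro q
  obtain ⟨ρ, U, hU, hρ, h⟩ := exists_contMDiffOn_leftInverse hι q
  have hqU := h.self_of_nhds.1
  have h1 := hρ.contMDiffOn_tangentMapWithin (m := 1) (by norm_num [one_add_one_eq_two])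
    hU.uniqueMDiffOn
  have h2 : ContMDiffAt I I'.tangent 1 (fun y => (⟨ι y, X (ι y)⟩ : TangentBundle I' M)) q :=
    (hX.contMDiffAt (x := ι q)).comp q
      ((hι.contMDiff.of_le ENat.LEInfty.out).contMDiffAt (x := q))
  have hUo : IsOpen (Bundle.TotalSpace.proj ⁻¹' U : Set (TangentBundle I' M)) :=
    hU.preimage (FiberBundle.continuous_proj E' (TangentSpace I'))
  have h3 : ContMDiffAt I'.tangent I.tangent 1 (tangentMapWithin I' I ρ U)
      (⟨ι q, X (ι q)⟩ : TangentBundle I' M) :=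
    h1.contMDiffAt (hUo.mem_nhds hqU)
  -- Near `q`, `Y` is the image of `X ∘ ι` under the tangent map of `ρ`, which expresses it through
  -- $C^1$ maps.
  refine (h3.comp q h2).congr_of_eventuallyEq ?_
  filter_upwards [h] with y hy
  obtain ⟨hyU, hρy, hw⟩ := hy
  have hd := hw (Y y)
  rw [hYX] at hd
  simp only [Function.comp_apply, tangentMapWithin]
  rw [mfderivWithin_of_mem_nhds (hU.mem_nhds hyU)]
  exact Bundle.TotalSpace.ext hρy.symm (heq_of_eq hd.symm)

/-- Curves in an immersed submanifold that are integral curves in the ambient manifold. -/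
lemma isMIntegralCurveOn_of_immersion (hι : Manifold.IsImmersion I I' ∞ ι)
    (hYX : ∀ q, mfderiv I I' ι q (Y q) = X (ι q)) {J : Set ℝ} {γ : ℝ → N} (hJ : IsOpen J) :
    IsMIntegralCurveOn (I := I) γ Y J ↔
      ContinuousOn γ J ∧ IsMIntegralCurveOn (I := I') (ι ∘ γ) X J := by
  constructor
  · refine fun h => ⟨h.continuousOn, fun t ht => ?_⟩
    have h2 : MDifferentiableAt I I' ι (γ t) := hι.contMDiff.mdifferentiableAt (by simp)
    have := h2.hasMFDerivAt.comp_hasMFDerivWithinAt t (h t ht)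
    refine this.congr_mfderiv ?_
    refine ContinuousLinearMap.ext fun r => ?_
    have h5 := congrArg (fun w : E' => (show ℝ from r) • w) (hYX (γ t))
    exact (map_smul _ (show ℝ from r) (Y (γ t))).trans h5
  · rintro ⟨hc, h⟩ t ht
    obtain ⟨ρ, U, hU, hρ, hev⟩ := exists_contMDiffOn_leftInverse hι (γ t)
    have hγ : ContinuousAt γ t := hc.continuousAt (hJ.mem_nhds ht)
    obtain ⟨htU, hρt, hw⟩ := hev.self_of_nhds
    have h1 : MDifferentiableAt I' I ρ (ι (γ t)) :=
      ((hρ.contMDiffAt (hU.mem_nhds htU)).mdifferentiableAt (by decide))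
    have h2 := (h1.hasMFDerivAt.comp t ((h t ht).hasMFDerivAt (hJ.mem_nhds ht)))
    -- Continuity of `γ` in `N` is essential: `ι` need not be an embedding, and `ρ` inverts it only
    -- near `γ t`.
    have h3 : γ =ᶠ[𝓝 t] ρ ∘ ι ∘ γ := by
      filter_upwards [hγ.eventually hev] with s hs using hs.2.1.symm
    have h5 := hw (Y (γ t))
    rw [hYX] at h5
    refine ((h2.congr_of_eventuallyEq h3).congr_mfderiv ?_).hasMFDerivWithinAt
    refine ContinuousLinearMap.ext fun r => ?_
    exact (map_smul _ (show ℝ from r) (X (ι (γ t)))).trans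
      (congrArg (fun w : E => (show ℝ from r) • w) h5)

end Immersion

/-! ### Level sets of maps with one-dimensional kernel -/

section LevelSet

variable {E F : Type*} [NormedAddCommGroup E] [NormedSpace ℝ E] [FiniteDimensional ℝ E]
  [NormedAddCommGroup F] [NormedSpace ℝ F]

lemma exists_injOn_of_hasStrictFDerivAt {f : E → F} {f' : E →L[ℝ] F} {x : E}
    (hf : HasStrictFDerivAt f f' x) (hinj : Function.Injective f') :
    ∃ U ∈ 𝓝 x, InjOn f U := by
  obtain ⟨K, hK, hA⟩ := (f' : E →ₗ[ℝ] F).exists_antilipschitzWith (LinearMap.ker_eq_bot.2 hinj)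
  have hK' : (0 : ℝ) < K := hK
  -- With error `K⁻¹ / 2`, two points of `U` with equal values satisfy `‖y - z‖ ≤ ‖y - z‖ / 2`.
  obtain ⟨U, hU, happ⟩ := hf.approximates_deriv_on_nhds (c := K⁻¹ / 2) (Or.inr (by positivity))
  refine ⟨U, hU, fun y hy z hz hyz => ?_⟩
  have h1 := happ y hy z hz
  rw [hyz, sub_self, zero_sub, norm_neg] at h1
  have h2 := hA.le_mul_dist (y - z) 0
  simp only [dist_zero_right, map_zero] at h2
  by_contra hne
  have h3 : 0 < ‖y - z‖ := norm_pos_iff.2 (sub_ne_zero.2 hne)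
  have h4 : ‖y - z‖ ≤ K * ((K : ℝ)⁻¹ / 2 * ‖y - z‖) := by
    refine h2.trans (mul_le_mul_of_nonneg_left ?_ hK'.le)
    simpa using h1
  have h5 : K * ((K : ℝ)⁻¹ / 2 * ‖y - z‖) = ‖y - z‖ / 2 := by field_simp
  linarith

/-- If the differential of `f` has a one-dimensional kernel, then near `x` the level set of `f` is
contained in any curve that stays in it with nonzero velocity at `x`. -/
lemma level_set_subset_curve {f : E → F} {f' : E →L[ℝ] F} {x ξ : E}
    (hf : HasStrictFDerivAt f f' x) (hξ : ξ ≠ 0) (hker : ∀ w, f' w = 0 → ∃ r : ℝ, w = r • ξ)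
    {c : ℝ → E} {u : Set ℝ} (hu : u ∈ 𝓝 0) (hc0 : c 0 = x) (hc : ContinuousOn c u)
    (hd : HasDerivAt c ξ 0) (hfc : ∀ t ∈ u, f (c t) = f x) :
    ∀ᶠ y in 𝓝 x, f y = f x → y ∈ c '' u := by
  obtain ⟨ψ, hψ⟩ : ∃ ψ : E →L[ℝ] ℝ, ψ ξ = 1 := by
    obtain ⟨ψ, hψ⟩ := SeparatingDual.exists_eq_one (R := ℝ) hξ
    exact ⟨ψ, hψ⟩
  -- Adjoining a functional with `ψ ξ = 1` kills the kernel line, so `(f, ψ)` is locally injective.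
  -- It then suffices to find a point of the curve with the same `ψ`-value as `y`.
  have hg : HasStrictFDerivAt (fun y => (f y, ψ y)) (f'.prod ψ) x :=
    hf.prodMk ψ.hasStrictFDerivAt
  have hinj : Function.Injective (f'.prod ψ) := by
    rw [injective_iff_map_eq_zero]
    intro w hw
    obtain ⟨h1, h2⟩ := Prod.ext_iff.1 hw
    obtain ⟨r, rfl⟩ := hker w h1
    have : r = 0 := by simpa [hψ] using h2
    rw [this, zero_smul]
  obtain ⟨U, hU, hUinj⟩ := exists_injOn_of_hasStrictFDerivAt hg hinj
  have hcU : ∀ᶠ t in 𝓝 (0 : ℝ), t ∈ u ∧ c t ∈ U :=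
    Filter.Eventually.and hu (hd.continuousAt.preimage_mem_nhds (by rwa [hc0]))
  obtain ⟨r, hr, hball⟩ := Metric.eventually_nhds_iff.1 hcU
  -- The derivative of `ψ ∘ c` at `0` is `1`, so `ψ (c (±τ))` lie on opposite sides of `ψ x`; the
  -- intermediate value theorem then reaches every value near `ψ x`.
  have hpos : ∀ᶠ t in 𝓝[≠] (0 : ℝ), 0 < (ψ (c t) - ψ x) / t := by
    have h1 : HasDerivAt (fun t => ψ (c t)) 1 0 := by
      have := ψ.hasFDerivAt.comp_hasDerivAt (0 : ℝ) hd
      rwa [hψ] at this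
    have h2 := h1.tendsto_slope.eventually (lt_mem_nhds one_pos)
    filter_upwards [h2] with t ht
    simpa [slope_def_field, hc0] using ht
  rw [eventually_nhdsWithin_iff] at hpos
  obtain ⟨s, hs, hball'⟩ := Metric.eventually_nhds_iff.1 hpos
  obtain ⟨τ, hτ0, hτ⟩ := exists_between (lt_min hr hs)
  have hτr := hτ.trans_le (min_le_left _ _)
  have hτs := hτ.trans_le (min_le_right _ _)
  have hp : ψ x < ψ (c τ) := by
    have := hball' (y := τ) (by simpa [abs_of_pos hτ0] using hτs) hτ0.ne'
    have := (div_pos_iff_of_pos_right hτ0).1 this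
    linarith
  have hn : ψ (c (-τ)) < ψ x := by
    have := hball' (y := -τ) (by simpa [abs_of_pos hτ0] using hτs) (by simpa using hτ0.ne')
    rw [div_neg, Left.neg_pos_iff] at this
    have := (div_neg_iff.1 this)
    rcases this with h | h <;> linarith [h.1, h.2]
  have hIcc : ∀ t ∈ Icc (-τ) τ, t ∈ u ∧ c t ∈ U := fun t ht => hball (by
    rw [Real.dist_eq, sub_zero]
    exact (abs_le.2 ht).trans_lt hτr)
  have hcont : ContinuousOn (fun t => ψ (c t)) (Icc (-τ) τ) :=
    ψ.continuous.comp_continuousOn (hc.mono fun t ht => (hIcc t ht).1)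
  have hivt := intermediate_value_Icc (by linarith) hcont
  filter_upwards [hU, ψ.continuous.continuousAt.preimage_mem_nhds (Ioo_mem_nhds hn hp)]
    with y hyU hy hfy
  obtain ⟨t, ht, hty⟩ := hivt ⟨hy.1.le, hy.2.le⟩
  exact ⟨t, (hIcc t ht).1, hUinj (hIcc t ht).2 hyU
    (Prod.ext ((hfc t (hIcc t ht).1).trans hfy.symm) hty)⟩

end LevelSet

/-! ### Leaves, plaques and transversal points -/

section Transversal

variable {m k d : ℕ} {M : Type*} [TopologicalSpace M] [ChartedSpace (EuclideanSpace ℝ (Fin m)) M]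
  [IsManifold (𝓡 m) ∞ M]
  {N : Type*} [TopologicalSpace N] [ChartedSpace (EuclideanSpace ℝ (Fin d)) N]
  [IsManifold (𝓡 d) ∞ N]

lemma finiteDimensional_tangentSpace (p : M) : FiniteDimensional ℝ (TangentSpace (𝓡 m) p) :=
  inferInstanceAs (FiniteDimensional ℝ (EuclideanSpace ℝ (Fin m)))

lemma finrank_tangentSpace (p : M) : Module.finrank ℝ (TangentSpace (𝓡 m) p) = m :=
  (finrank_euclideanSpace_fin (𝕜 := ℝ) (n := m))

lemma hasFDerivAt_comp_extChartAt_symm {F : Type*} [NormedAddCommGroup F] [NormedSpace ℝ F]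
    {f : N → F} {q : N} {A : EuclideanSpace ℝ (Fin d) →L[ℝ] F}
    (h : HasMFDerivAt (𝓡 d) 𝓘(ℝ, F) f q A) :
    HasFDerivAt (fun u => f ((extChartAt (𝓡 d) q).symm u)) A (extChartAt (𝓡 d) q q) := by
  have h1 : HasFDerivWithinAt (fun u => f ((extChartAt (𝓡 d) q).symm u)) A (range (𝓡 d))
    (extChartAt (𝓡 d) q q) := h.2
  rwa [ModelWithCorners.Boundaryless.range_eq_univ, hasFDerivWithinAt_univ] at h1

lemma hasFDerivAt_extChartAt_comp {σ : ℝ → N} {t : ℝ} {A : ℝ →L[ℝ] EuclideanSpace ℝ (Fin d)}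
    (h : HasMFDerivAt 𝓘(ℝ, ℝ) (𝓡 d) σ t A) :
    HasFDerivAt (fun s => extChartAt (𝓡 d) (σ t) (σ s)) A t := by
  have h1 : HasFDerivWithinAt (fun s => extChartAt (𝓡 d) (σ t) (σ s)) A (range 𝓘(ℝ, ℝ)) t := h.2
  rwa [ModelWithCorners.Boundaryless.range_eq_univ, hasFDerivWithinAt_univ] at h1

lemma maximalAtlas_mono {φ : OpenPartialHomeomorph M (EuclideanSpace ℝ (Fin m))}
    (hφ : φ ∈ IsManifold.maximalAtlas (𝓡 m) ∞ M) : φ ∈ IsManifold.maximalAtlas (𝓡 m) 1 M :=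
  IsManifold.maximalAtlas_subset_of_le (m := 1) ENat.LEInfty.out hφ

lemma mfderiv_injective_of_mem_maximalAtlas
    {φ : OpenPartialHomeomorph M (EuclideanSpace ℝ (Fin m))}
    (hφ : φ ∈ IsManifold.maximalAtlas (𝓡 m) ∞ M) {p : M} (hp : p ∈ φ.source) :
    Function.Injective (mfderiv (𝓡 m) (𝓡 m) φ p) := by
  have : IsManifold (𝓡 m) 1 M := inferInstance
  have h : φ.MDifferentiable (𝓡 m) (𝓡 m) :=
    ⟨fun x hx => (mdifferentiableAt_of_mem_maximalAtlas (maximalAtlas_mono (m := m) hφ)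
        hx).mdifferentiableWithinAt,
      fun x hx => (mdifferentiableAt_symm_of_mem_maximalAtlas (maximalAtlas_mono hφ)
        hx).mdifferentiableWithinAt⟩
  exact h.mfderiv_injective hp

/-- The definition tests all distinguished charts. The subspace cut out by a single one contains the
tangent space and has dimension at most `k`, so equality follows from `hdim`. -/
lemma Foliation.mem_tangentSpace_of_isDistinguished (𝓕 : Foliation m M k)
    {φ : OpenPartialHomeomorph M (EuclideanSpace ℝ (Fin m))}
    (hφ : φ ∈ IsManifold.maximalAtlas (𝓡 m) ∞ M) (hd : IsDistinguished k 𝓕.leaves φ)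
    {p : M} (hp : p ∈ φ.source) (hdim : Module.finrank ℝ (𝓕.tangentSpace p) = k)
    {w : TangentSpace (𝓡 m) p} (hw : ∀ i : Fin m, k ≤ (i : ℕ) →
      (show EuclideanSpace ℝ (Fin m) from mfderiv (𝓡 m) (𝓡 m) φ p w) i = 0) :
    w ∈ 𝓕.tangentSpace p := by
  have := finiteDimensional_tangentSpace (m := m) p
  let A : TangentSpace (𝓡 m) p →ₗ[ℝ] EuclideanSpace ℝ (Fin m) :=
    (mfderiv (𝓡 m) (𝓡 m) φ p).toLinearMap
  have hA : Function.Injective A := mfderiv_injective_of_mem_maximalAtlas hφ hp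
  let W : Submodule ℝ (TangentSpace (𝓡 m) p) :=
    { carrier := {w | ∀ i : Fin m, k ≤ (i : ℕ) → A w i = 0}
      zero_mem' := fun i _ => by simp
      add_mem' := fun {a b} ha hb i hi => by simp [ha i hi, hb i hi]
      smul_mem' := fun c a ha i hi => by simp [ha i hi] }
  have hTW : 𝓕.tangentSpace p ≤ W := fun u hu => hu φ hφ hp hd
  -- The first `k` coordinates determine a vector of `W`; the default `0` covers indices `j ≥ m`, as
  -- `k ≤ m` is not assumed.
  let R : W →ₗ[ℝ] (Fin k → ℝ) :=
    { toFun := fun w j => if h : (j : ℕ) < m then A w.1 ⟨j, h⟩ else 0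
      map_add' := fun a b => by ext j; by_cases h : (j : ℕ) < m <;> simp [h]
      map_smul' := fun c a => by ext j; by_cases h : (j : ℕ) < m <;> simp [h] }
  have hR : Function.Injective R := by
    intro a b hab
    apply Subtype.ext
    apply hA
    ext i
    by_cases hi : k ≤ (i : ℕ)
    · rw [a.2 i hi, b.2 i hi]
    · have := congrFun hab ⟨i, not_le.1 hi⟩
      simpa [R] using this
  have hle : Module.finrank ℝ W ≤ k := by
    simpa using LinearMap.finrank_le_finrank_of_injective hR
  have := Submodule.eq_of_le_of_finrank_le hTW (hle.trans hdim.ge)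
  rw [this]
  exact hw

variable {𝓕 : Foliation m M k} {ι : N → M} {X : (p : M) → TangentSpace (𝓡 m) p}
  {Y : (q : N) → TangentSpace (𝓡 d) q}

/-- The coordinates transversal to the leaves are constant along curves tangent to the leaves. -/
lemma Foliation.eventually_coord_eq (𝓕 : Foliation m M k)
    {φ : OpenPartialHomeomorph M (EuclideanSpace ℝ (Fin m))}
    (hφ : φ ∈ IsManifold.maximalAtlas (𝓡 m) ∞ M) (hd : IsDistinguished k 𝓕.leaves φ)
    {c : ℝ → M} {J : Set ℝ} (hJ : IsOpen J) (hc : IsMIntegralCurveOn (I := 𝓡 m) c X J)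
    (hX : ∀ t ∈ J, X (c t) ∈ 𝓕.tangentSpace (c t)) {t₀ : ℝ} (ht₀ : t₀ ∈ J)
    (hs : c t₀ ∈ φ.source) :
    ∀ᶠ t in 𝓝 t₀, c t ∈ φ.source ∧ ∀ i : Fin m, k ≤ (i : ℕ) → φ (c t) i = φ (c t₀) i := by
  have hcont : ContinuousAt c t₀ := (hc.continuousOn).continuousAt (hJ.mem_nhds ht₀)
  have hev : ∀ᶠ t in 𝓝 t₀, t ∈ J ∧ c t ∈ φ.source :=
    Filter.Eventually.and (hJ.mem_nhds ht₀)
      (hcont.preimage_mem_nhds (φ.open_source.mem_nhds hs))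
  obtain ⟨r, hr, hb⟩ := Metric.eventually_nhds_iff_ball.1 hev
  have hder : ∀ i : Fin m, k ≤ (i : ℕ) → ∀ t ∈ Metric.ball t₀ r,
      HasDerivAt (fun t => φ (c t) i) 0 t := by
    intro i hi t ht
    obtain ⟨htJ, hts⟩ := hb t ht
    have h1 := (hc t htJ).hasMFDerivAt (hJ.mem_nhds htJ)
    have h2 := (mdifferentiableAt_of_mem_maximalAtlas (maximalAtlas_mono hφ) hts).hasMFDerivAt
    have h3 := (h2.comp t h1).hasFDerivAt
    have h4 := ((EuclideanSpace.proj (𝕜 := ℝ) i).hasFDerivAt.comp t h3).hasDerivAt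
    have h5 := hX t htJ φ hφ hts hd i hi
    convert! h4 using 1
    refine h5.symm.trans ?_
    have h6 : ∀ (A : EuclideanSpace ℝ (Fin m) →L[ℝ] EuclideanSpace ℝ (Fin m))
        (x : EuclideanSpace ℝ (Fin m)), (A x) i = (EuclideanSpace.proj (𝕜 := ℝ) i ∘L
          (A ∘L (ContinuousLinearMap.smulRight (1 : ℝ →L[ℝ] ℝ) x))) 1 := by
      intro A x; simp
    exact h6 _ _
  filter_upwards [Metric.ball_mem_nhds t₀ hr] with t ht
  refine ⟨(hb t ht).2, fun i hi => ?_⟩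
  exact (Metric.isOpen_ball).is_const_of_deriv_eq_zero (convex_ball t₀ r).isPreconnected
    (fun s hs => (hder i hi s hs).differentiableAt.differentiableWithinAt)
    (fun s hs => (hder i hi s hs).deriv) ht (Metric.mem_ball_self hr)

lemma Foliation.exists_mem_leaf (𝓕 : Foliation m M k) (p : M) : ∃ L ∈ 𝓕.leaves, p ∈ L := by
  obtain ⟨L, ⟨hL, hp⟩, -⟩ := 𝓕.isPartition.2 p
  exact ⟨L, hL, hp⟩

lemma Foliation.leaf_eq (𝓕 : Foliation m M k) {p : M} {L L' : Set M} (hL : L ∈ 𝓕.leaves)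
    (hL' : L' ∈ 𝓕.leaves) (hp : p ∈ L) (hp' : p ∈ L') : L = L' :=
  (𝓕.isPartition.2 p).unique ⟨hL, hp⟩ ⟨hL', hp'⟩

lemma Foliation.mem_leaf_of_coord_eq (𝓕 : Foliation m M k)
    {φ : OpenPartialHomeomorph M (EuclideanSpace ℝ (Fin m))} (hd : IsDistinguished k 𝓕.leaves φ)
    {p x : M} {L : Set M} (hL : L ∈ 𝓕.leaves) (hpL : p ∈ L) (hp : p ∈ φ.source)
    (hx : x ∈ φ.source) (h : ∀ i : Fin m, k ≤ (i : ℕ) → φ x i = φ p i) : x ∈ L := by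
  have h1 : x ∈ connectedComponentIn (L ∩ φ.source) p := by
    rw [hd L hL p ⟨hpL, hp⟩]
    exact ⟨hx, h⟩
  exact (connectedComponentIn_subset _ _ h1).1

/-- A curve tangent to a foliation stays in a leaf. -/
lemma Foliation.mem_leaf_of_tangent (𝓕 : Foliation m M k) {c : ℝ → M} {J : Set ℝ} (hJ : IsOpen J)
    (hJc : J.OrdConnected) (hc : IsMIntegralCurveOn (I := 𝓡 m) c X J)
    (hX : ∀ t ∈ J, X (c t) ∈ 𝓕.tangentSpace (c t)) {L : Set M} (hL : L ∈ 𝓕.leaves) {t₀ t : ℝ}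
    (ht₀ : t₀ ∈ J) (hcL : c t₀ ∈ L) (ht : t ∈ J) : c t ∈ L := by
  -- Lying in the same leaf is an equivalence relation on times; on a connected interval it suffices
  -- to verify it locally, where constancy of the transversal coordinates gives it.
  have key := hJc.isPreconnected.induction₂ (fun s t => ∀ L ∈ 𝓕.leaves, c s ∈ L ↔ c t ∈ L) ?_
    (fun x y z _ _ _ h1 h2 L hL => (h1 L hL).trans (h2 L hL))
    (fun x y _ _ h L hL => (h L hL).symm) ht₀ ht
  · exact (key L hL).1 hcL
  intro s hs
  obtain ⟨φ, hφ, hsφ, hd⟩ := 𝓕.exists_chart (c s)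
  obtain ⟨L', hL', hsL'⟩ := 𝓕.exists_mem_leaf (c s)
  refine nhdsWithin_le_nhds ?_
  filter_upwards [𝓕.eventually_coord_eq hφ hd hJ hc hX hs hsφ] with t ht
  have htL' := 𝓕.mem_leaf_of_coord_eq hd hL' hsL' hsφ ht.1 ht.2
  intro L hL
  constructor
  · intro h
    rwa [𝓕.leaf_eq hL hL' h hsL']
  · intro h
    rwa [𝓕.leaf_eq hL hL' h htL']

/-- `Y` is a smooth field of directions of the intersections of the foliation `𝓕` with the immersed
submanifold `ι`, induced by `X` and vanishing where they are not transversal. -/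
structure IsIntersectionField (𝓕 : Foliation m M k) (ι : N → M)
    (X : (p : M) → TangentSpace (𝓡 m) p) (Y : (q : N) → TangentSpace (𝓡 d) q) : Prop where
  isImmersion : Manifold.IsImmersion (𝓡 d) (𝓡 m) ∞ ι
  contMDiff : ContMDiff (𝓡 m) (𝓡 m).tangent 1 (fun p => (⟨p, X p⟩ : TangentBundle (𝓡 m) M))
  mfderiv_eq : ∀ q, mfderiv (𝓡 d) (𝓡 m) ι q (Y q) = X (ι q)
  mem_tangentSpace : ∀ q, X (ι q) ∈ 𝓕.tangentSpace (ι q)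
  ne_zero_iff : ∀ q, X (ι q) ≠ 0 ↔ 𝓕.IsTransversalAt d ι q
  finrank_eq : ∀ p, Module.finrank ℝ (𝓕.tangentSpace p) = k
  codim_eq : k + d = m + 1

namespace IsIntersectionField

variable (h : IsIntersectionField 𝓕 ι X Y)
include h

lemma contMDiff_trace :
    ContMDiff (𝓡 d) (𝓡 d).tangent 1 (fun q => (⟨q, Y q⟩ : TangentBundle (𝓡 d) N)) :=
  contMDiff_of_mfderiv_eq h.isImmersion h.contMDiff h.mfderiv_eq

lemma trace_ne_zero_iff (q : N) : Y q ≠ 0 ↔ 𝓕.IsTransversalAt d ι q := by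
  rw [← h.ne_zero_iff, ← h.mfderiv_eq, ← map_zero (mfderiv (𝓡 d) (𝓡 m) ι q)]
  exact (mfderiv_injective_of_isImmersion h.isImmersion q).ne_iff.symm

lemma isOpenIntegralCurve_iff {J : Set ℝ} {γ : ℝ → N} :
    IsIntegralCurveIn X ι J γ ↔ IsOpenIntegralCurve Y J γ := by
  constructor
  · rintro ⟨h1, h2, h3, h4⟩
    exact ⟨h1, h2, (isMIntegralCurveOn_of_immersion h.isImmersion h.mfderiv_eq h1).2 ⟨h3, h4⟩⟩
  · rintro ⟨h1, h2, h3⟩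
    obtain ⟨h4, h5⟩ := (isMIntegralCurveOn_of_immersion h.isImmersion h.mfderiv_eq h1).1 h3
    exact ⟨h1, h2, h4, h5⟩

lemma isLineOfForce_iff {C : Set N} :
    IsLineOfForce X ι C ↔ ∃ J γ, J.Nonempty ∧ IsMaximalIntegralCurve Y J γ ∧
      (∀ t ∈ J, Y (γ t) ≠ 0) ∧ C = γ '' J := by
  simp only [IsLineOfForce, IsMaximalIntegralCurve, h.isOpenIntegralCurve_iff, h.ne_zero_iff,
    h.trace_ne_zero_iff, and_assoc]

/-- At transversal points the intersection of the tangent spaces is a line. -/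
lemma exists_eq_smul {q : N} (hq : 𝓕.IsTransversalAt d ι q) {w : TangentSpace (𝓡 d) q}
    (hw : mfderiv (𝓡 d) (𝓡 m) ι q w ∈ 𝓕.tangentSpace (ι q)) : ∃ r : ℝ, w = r • Y q := by
  have := finiteDimensional_tangentSpace (m := m) (ι q)
  have := finiteDimensional_tangentSpace (m := d) q
  have hR : Module.finrank ℝ (immersedTangentSpace (m := m) d ι q) ≤ d :=
    (LinearMap.finrank_range_le _).trans (finrank_tangentSpace (m := d) q).le
  have hsum := Submodule.finrank_sup_add_finrank_inf_eq (𝓕.tangentSpace (ι q))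
    (immersedTangentSpace (m := m) d ι q)
  rw [show 𝓕.tangentSpace (ι q) ⊔ immersedTangentSpace (m := m) d ι q = ⊤ from hq, finrank_top,
    finrank_tangentSpace, h.finrank_eq] at hsum
  have hcodim := h.codim_eq
  set W := 𝓕.tangentSpace (ι q) ⊓ immersedTangentSpace (m := m) d ι q with hW
  -- The dimension formula reads `m + dim W ≤ k + d`, and `k + d = m + 1`.
  have hle : Module.finrank ℝ W ≤ 1 := by omega
  have hXW : X (ι q) ∈ W := ⟨h.mem_tangentSpace q, ⟨Y q, h.mfderiv_eq q⟩⟩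
  have hX0 := (h.ne_zero_iff q).2 hq
  have hone : Module.finrank ℝ W = 1 := by
    refine le_antisymm hle (Nat.one_le_iff_ne_zero.2 fun h0 => hX0 ?_)
    have hbot := Submodule.finrank_eq_zero.1 h0
    rw [hbot] at hXW
    exact hXW
  obtain ⟨r, hr⟩ := (finrank_eq_one_iff_of_nonzero' (⟨_, hXW⟩ : W)
    (fun h0 => hX0 (congrArg Subtype.val h0))).1 hone ⟨_, ⟨hw, ⟨w, rfl⟩⟩⟩
  refine ⟨r, mfderiv_injective_of_isImmersion h.isImmersion q ?_⟩
  rw [map_smul, h.mfderiv_eq]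
  exact (congrArg Subtype.val hr).symm

lemma tangent_of_isOpenIntegralCurve {J : Set ℝ} {γ : ℝ → N} (hγ : IsOpenIntegralCurve Y J γ) :
    IsMIntegralCurveOn (I := 𝓡 m) (ι ∘ γ) X J :=
  (h.isOpenIntegralCurve_iff.2 hγ).2.2.2

/-- Near a transversal point, the plaque through it meets the submanifold in an integral curve. -/
lemma eventually_mem_image {J : Set ℝ} {σ : ℝ → N} (hσ : IsOpenIntegralCurve Y J σ)
    (h0 : 0 ∈ J) (hq : 𝓕.IsTransversalAt d ι (σ 0))
    {φ : OpenPartialHomeomorph M (EuclideanSpace ℝ (Fin m))}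
    (hφ : φ ∈ IsManifold.maximalAtlas (𝓡 m) ∞ M) (hd : IsDistinguished k 𝓕.leaves φ)
    (hs : ι (σ 0) ∈ φ.source) :
    ∀ᶠ y in 𝓝 (σ 0), (∀ i : Fin m, k ≤ (i : ℕ) → φ (ι y) i = φ (ι (σ 0)) i) → y ∈ σ '' J := by
  set χ := extChartAt (𝓡 d) (σ 0) with hχ
  -- `P` erases the coordinates along the plaques, so plaques in `φ` are level sets of `P ∘ φ`.
  let P : EuclideanSpace ℝ (Fin m) →L[ℝ] (Fin m → ℝ) :=
    ContinuousLinearMap.pi fun i => if k ≤ (i : ℕ) then EuclideanSpace.proj i else 0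
  have hP : ∀ x y, P x = P y ↔ ∀ i : Fin m, k ≤ (i : ℕ) → x i = y i := by
    intro x y
    simp only [funext_iff, P, ContinuousLinearMap.pi_apply]
    refine forall_congr' fun i => ?_
    by_cases hi : k ≤ (i : ℕ) <;> simp [hi]
  have hsm : ContMDiffAt (𝓡 d) 𝓘(ℝ, Fin m → ℝ) 1 (fun y => P (φ (ι y))) (σ 0) := by
    have h1 : ContMDiffAt (𝓡 m) (𝓡 m) 1 φ (ι (σ 0)) :=
      contMDiffAt_of_mem_maximalAtlas (maximalAtlas_mono hφ) hs
    have h2 : ContMDiffAt (𝓡 d) (𝓡 m) 1 ι (σ 0) :=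
      (h.isImmersion.contMDiff.of_le ENat.LEInfty.out).contMDiffAt
    exact (P.contDiff.contMDiff.contMDiffAt).comp (σ 0) (h1.comp (σ 0) h2)
  have hder : HasMFDerivAt (𝓡 d) 𝓘(ℝ, Fin m → ℝ) (fun y => P (φ (ι y))) (σ 0)
      (P ∘L (mfderiv (𝓡 m) (𝓡 m) φ (ι (σ 0)) ∘L mfderiv (𝓡 d) (𝓡 m) ι (σ 0))) := by
    have h1 := (mdifferentiableAt_of_mem_maximalAtlas (maximalAtlas_mono hφ) hs).hasMFDerivAt
    have h2 : MDifferentiableAt (𝓡 d) (𝓡 m) ι (σ 0) :=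
      h.isImmersion.contMDiff.mdifferentiableAt (by simp)
    exact P.hasFDerivAt.hasMFDerivAt.comp (σ 0) (h1.comp (σ 0) h2.hasMFDerivAt)
  set f : EuclideanSpace ℝ (Fin d) → (Fin m → ℝ) := fun u => P (φ (ι (χ.symm u))) with hf
  have hstrict : HasStrictFDerivAt f
      (P ∘L (mfderiv (𝓡 m) (𝓡 m) φ (ι (σ 0)) ∘L mfderiv (𝓡 d) (𝓡 m) ι (σ 0))) (χ (σ 0)) := by
    have h1 : HasFDerivAt f (P ∘L (mfderiv (𝓡 m) (𝓡 m) φ (ι (σ 0)) ∘L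
        mfderiv (𝓡 d) (𝓡 m) ι (σ 0))) (χ (σ 0)) := hasFDerivAt_comp_extChartAt_symm hder
    have h2 : ContDiffAt ℝ 1 f (χ (σ 0)) := by
      have := (contMDiffAt_iff.1 hsm).2
      rw [ModelWithCorners.Boundaryless.range_eq_univ, contDiffWithinAt_univ] at this
      exact this
    exact h2.hasStrictFDerivAt' h1 (by simp)
  have hY0 : Y (σ 0) ≠ 0 := (h.trace_ne_zero_iff _).2 hq
  have hcσ : ContinuousAt σ 0 := hσ.isMIntegralCurveOn.continuousOn.continuousAt
    (hσ.isOpen.mem_nhds h0)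
  have hu : {t | t ∈ J ∧ σ t ∈ χ.source ∧
      ∀ i : Fin m, k ≤ (i : ℕ) → φ (ι (σ t)) i = φ (ι (σ 0)) i} ∈ 𝓝 (0 : ℝ) := by
    filter_upwards [hσ.isOpen.mem_nhds h0,
      hcσ.preimage_mem_nhds (extChartAt_source_mem_nhds (I := 𝓡 d) (σ 0)),
      𝓕.eventually_coord_eq hφ hd hσ.isOpen (h.tangent_of_isOpenIntegralCurve hσ)
        (fun t _ => h.mem_tangentSpace (σ t)) h0 hs] with t h1 h2 h3
    exact ⟨h1, h2, h3.2⟩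
  have hdc : HasDerivAt (fun t => χ (σ t)) (Y (σ 0)) 0 := by
    have h1 := ((hσ.isMIntegralCurveOn 0 h0).hasMFDerivAt (hσ.isOpen.mem_nhds h0))
    have h2 := (hasFDerivAt_extChartAt_comp h1).hasDerivAt
    exact h2.congr_deriv (one_smul ℝ (Y (σ 0)))
  -- In the chart `χ`, the kernel hypothesis is the statement that the leaf and the submanifold meet
  -- infinitesimally in the line spanned by `Y`.
  have key := level_set_subset_curve (x := χ (σ 0)) (c := fun t => χ (σ t)) hstrict hY0 ?_ hu rfl
    ?_ hdc ?_
  · have hχc : ContinuousAt χ (σ 0) := continuousAt_extChartAt (σ 0)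
    filter_upwards [hχc.eventually key, extChartAt_source_mem_nhds (I := 𝓡 d) (σ 0)] with y hy hys
    intro hyi
    obtain ⟨t, ⟨htJ, hts, -⟩, hty⟩ := hy (by
      simp only [hf]
      rw [χ.left_inv hys, χ.left_inv (mem_extChartAt_source (σ 0))]
      exact (hP _ _).2 hyi)
    exact ⟨t, htJ, χ.injOn hts hys hty⟩
  · intro w hw
    refine h.exists_eq_smul hq (w := w) (𝓕.mem_tangentSpace_of_isDistinguished hφ hd hs
      (h.finrank_eq _) ?_)
    have hw' := (hP _ 0).1 (hw.trans (map_zero P).symm)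
    exact hw'
  · intro t ht
    exact ((continuousAt_extChartAt' (I := 𝓡 d) ht.2.1).comp_continuousWithinAt
      ((hσ.isMIntegralCurveOn.continuousOn t ht.1).mono fun s hs => hs.1))
  · intro t ht
    simp only [hf]
    rw [χ.left_inv ht.2.1, χ.left_inv (mem_extChartAt_source (σ 0))]
    exact (hP _ _).2 ht.2.2

end IsIntersectionField

end Transversal

/-! ### Lines of force as components of the transversal intersection -/

section LinesOfForce

variable {m k d : ℕ} {M : Type*} [TopologicalSpace M] [ChartedSpace (EuclideanSpace ℝ (Fin m)) M]
  [IsManifold (𝓡 m) ∞ M]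
  {N : Type*} [TopologicalSpace N] [ChartedSpace (EuclideanSpace ℝ (Fin d)) N]
  [IsManifold (𝓡 d) ∞ N] {𝓕 : Foliation m M k} {ι : N → M} {X : (p : M) → TangentSpace (𝓡 m) p}
  {Y : (q : N) → TangentSpace (𝓡 d) q}

namespace IsIntersectionField

variable [T2Space N] (h : IsIntersectionField 𝓕 ι X Y)
include h

/-- A path in a component of the transversal intersection stays on integral curves. -/
lemma eventually_mem_image_of_path {L : Set M} (hL : L ∈ 𝓕.leaves) {J : Set ℝ} {σ : ℝ → N}
    (hσ : IsOpenIntegralCurve Y J σ) (h0 : 0 ∈ J) (hq : 𝓕.IsTransversalAt d ι (σ 0))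
    {δ : ℝ → N} (hδ : Continuous δ) (hδL : ∀ s, ι (δ s) ∈ L) {s₀ : ℝ}
    (hs₀ : δ s₀ = σ 0) : ∀ᶠ s in 𝓝 s₀, δ s ∈ σ '' J := by
  obtain ⟨φ, hφ, hsφ, hd⟩ := 𝓕.exists_chart (ι (σ 0))
  have hιδ : Continuous (fun s => ι (δ s)) := h.isImmersion.contMDiff.continuous.comp hδ
  have hV : IsOpen ((fun s => ι (δ s)) ⁻¹' φ.source) := φ.open_source.preimage hιδ
  have hsV : s₀ ∈ (fun s => ι (δ s)) ⁻¹' φ.source := by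
    rw [mem_preimage, hs₀]; exact hsφ
  -- A leaf may cross the chart in many plaques; connectedness of `V₀` keeps this piece of the path
  -- in the plaque of `σ 0`.
  set V₀ := connectedComponentIn ((fun s => ι (δ s)) ⁻¹' φ.source) s₀ with hV₀
  have hV₀n : V₀ ∈ 𝓝 s₀ := hV.connectedComponentIn.mem_nhds (mem_connectedComponentIn hsV)
  have hplaque : ∀ s ∈ V₀, ∀ i : Fin m, k ≤ (i : ℕ) → φ (ι (δ s)) i = φ (ι (σ 0)) i := by
    have hsub : (fun s => ι (δ s)) '' V₀ ⊆ connectedComponentIn (L ∩ φ.source) (ι (σ 0)) := by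
      refine (isPreconnected_connectedComponentIn.image _ hιδ.continuousOn).subset_connectedComponentIn
        ⟨s₀, mem_connectedComponentIn hsV, by simp [hs₀]⟩ ?_
      rintro _ ⟨s, hs, rfl⟩
      exact ⟨hδL s, connectedComponentIn_subset ((fun s => ι (δ s)) ⁻¹' φ.source) s₀ hs⟩
    rw [hd L hL (ι (σ 0)) ⟨hs₀ ▸ hδL s₀, hsφ⟩] at hsub
    exact fun s hs => (hsub ⟨s, hs, rfl⟩).2
  have hev := h.eventually_mem_image hσ h0 hq hφ hd hsφ
  rw [← hs₀] at hev
  filter_upwards [hV₀n, hδ.continuousAt.eventually hev] with s hs hs'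
  exact hs' fun i hi => by rw [hplaque s hs i hi, hs₀]

/-- The maximal integral curves through transversal points are the components of the transversal
intersection. -/
lemma image_eq_pathComponentIn {J : Set ℝ} {γ : ℝ → N} (hγ : IsMaximalIntegralCurve Y J γ)
    {t₀ : ℝ} (ht₀ : t₀ ∈ J) {L : Set M} (hL : L ∈ 𝓕.leaves) (hγL : ι (γ t₀) ∈ L)
    (hq : 𝓕.IsTransversalAt d ι (γ t₀)) :
    γ '' J = pathComponentIn {q' : N | ι q' ∈ L ∧ 𝓕.IsTransversalAt d ι q'} (γ t₀) := by
  have hY := h.contMDiff_trace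
  apply Subset.antisymm
  · refine IsPathConnected.subset_pathComponentIn ?_ ⟨t₀, ht₀, rfl⟩ ?_
    · have hJ : IsPathConnected J :=
        (convex_iff_ordConnected.2 hγ.1.ordConnected).isPathConnected ⟨t₀, ht₀⟩
      exact hJ.image' hγ.1.isMIntegralCurveOn.continuousOn
    · rintro _ ⟨t, ht, rfl⟩
      refine ⟨?_, (h.trace_ne_zero_iff _).1
        (hγ.1.ne_zero hY ht₀ ht ((h.trace_ne_zero_iff _).2 hq))⟩
      exact 𝓕.mem_leaf_of_tangent hγ.1.isOpen hγ.1.ordConnected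
        (h.tangent_of_isOpenIntegralCurve hγ.1) (fun s _ => h.mem_tangentSpace (γ s)) hL ht₀ hγL ht
  · rintro y ⟨δ, hδ⟩
    have hδ' : ∀ s : ℝ, δ.extend s ∈ {q' : N | ι q' ∈ L ∧ 𝓕.IsTransversalAt d ι q'} :=
      fun s => hδ _
    -- Near each time the path stays in one integral curve `C`, which lies inside `γ '' J` as soon
    -- as it meets it. This makes both the set of times on `γ '' J` and its complement open.
    have key : ∀ s₀, ∃ C : Set N, δ.extend s₀ ∈ C ∧ (∀ᶠ s in 𝓝 s₀, δ.extend s ∈ C) ∧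
        ∀ z ∈ C, z ∈ γ '' J → C ⊆ γ '' J := by
      intro s₀
      obtain ⟨K, σ, hσ, h0, hσ0⟩ := exists_isOpenIntegralCurve hY (δ.extend s₀) 0
      refine ⟨σ '' K, ⟨0, h0, hσ0⟩, h.eventually_mem_image_of_path hL hσ h0
        (hσ0 ▸ (hδ' s₀).2) δ.continuous_extend (fun s => (hδ' s).1) hσ0.symm, ?_⟩
      rintro _ ⟨t, ht, rfl⟩ ⟨u, hu, hut⟩
      exact hγ.image_subset hY hσ hu ht hut.symm
    have hclopen : IsClopen {s | δ.extend s ∈ γ '' J} := by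
      refine ⟨isOpen_compl_iff.1 (isOpen_iff_mem_nhds.2 fun s₀ hs₀ => ?_),
        isOpen_iff_mem_nhds.2 fun s₀ hs₀ => ?_⟩ <;> obtain ⟨C, h1, h2, h3⟩ := key s₀ <;>
        filter_upwards [h2] with s hs
      · exact fun hs' => hs₀ (h3 _ hs hs' h1)
      · exact h3 _ h1 hs₀ hs
    have huniv := hclopen.eq_univ ⟨0, by
      rw [mem_ofPred_eq, δ.extend_zero]
      exact ⟨t₀, ht₀, rfl⟩⟩
    have h1 : (1 : ℝ) ∈ {s | δ.extend s ∈ γ '' J} := huniv ▸ mem_univ _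
    rwa [mem_ofPred_eq, δ.extend_one] at h1

/-- The lines of force are the components of the transversal intersection. -/
theorem setOf_isLineOfForce :
    {C : Set N | IsLineOfForce X ι C} = 𝓕.transversalIntersection d ι := by
  ext C
  rw [mem_ofPred_eq, h.isLineOfForce_iff]
  constructor
  · rintro ⟨J, γ, ⟨t, ht⟩, hγ, hne, rfl⟩
    obtain ⟨L, hL, hγL⟩ := 𝓕.exists_mem_leaf (ι (γ t))
    have hq := (h.trace_ne_zero_iff _).1 (hne t ht)
    exact ⟨L, hL, γ t, hγL, hq, h.image_eq_pathComponentIn hγ ht hL hγL hq⟩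
  · rintro ⟨L, hL, q, hqL, hq, rfl⟩
    obtain ⟨J, γ, hγ, ht, rfl⟩ := exists_isMaximalIntegralCurve h.contMDiff_trace q 0
    exact ⟨J, γ, ⟨0, ht⟩, hγ, fun s hs => hγ.1.ne_zero h.contMDiff_trace ht hs
      ((h.trace_ne_zero_iff _).2 hq), (h.image_eq_pathComponentIn hγ ht hL hqL hq).symm⟩

/-- Lines of force pass through the points of transversality. -/
theorem exists_isLineOfForce_iff (q : N) :
    (∃ C, IsLineOfForce X ι C ∧ q ∈ C) ↔ 𝓕.IsTransversalAt d ι q := by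
  simp only [h.isLineOfForce_iff]
  constructor
  · rintro ⟨_, ⟨J, γ, -, -, hne, rfl⟩, ⟨t, ht, rfl⟩⟩
    exact (h.trace_ne_zero_iff _).1 (hne t ht)
  · intro hq
    obtain ⟨J, γ, hγ, ht, rfl⟩ := exists_isMaximalIntegralCurve h.contMDiff_trace q 0
    exact ⟨γ '' J, ⟨J, γ, ⟨0, ht⟩, hγ, fun s hs => hγ.1.ne_zero h.contMDiff_trace ht hs
      ((h.trace_ne_zero_iff _).2 hq), rfl⟩, ⟨0, ht, rfl⟩⟩

end IsIntersectionField

end LinesOfForce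

/-! ### Smoothness of vector fields obtained by raising an index -/

section Smoothness

variable {M : Type*} [TopologicalSpace M] [ChartedSpace (EuclideanSpace ℝ (Fin 4)) M]

/-- A basis of the finite-dimensional `V` identifies `V →L[ℝ] F` with a finite power of `F`, and the
components are evaluations. -/
lemma contMDiffAt_clm_of_apply {m : ℕ} {M : Type*} [TopologicalSpace M]
    [ChartedSpace (EuclideanSpace ℝ (Fin m)) M]
    {V F : Type*} [NormedAddCommGroup V] [NormedSpace ℝ V]
    [FiniteDimensional ℝ V] [NormedAddCommGroup F] [NormedSpace ℝ F] {n : ℕ∞ω}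
    {A : M → V →L[ℝ] F} {p : M}
    (h : ∀ a, ContMDiffAt (𝓡 m) 𝓘(ℝ, F) n (fun x => A x a) p) :
    ContMDiffAt (𝓡 m) 𝓘(ℝ, V →L[ℝ] F) n A p := by
  let d := Module.finrank ℝ V
  have hd : d = Module.finrank ℝ (Fin d → ℝ) := (Module.finrank_fin_fun ℝ).symm
  let e₁ := ContinuousLinearEquiv.ofFinrankEq hd
  let e₂ := (e₁.arrowCongr (1 : F ≃L[ℝ] F)).trans (ContinuousLinearEquiv.piRing (Fin d))
  have h1 : ContMDiffAt (𝓡 m) 𝓘(ℝ, Fin d → F) n (fun x => e₂ (A x)) p :=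
    contMDiffAt_pi_space.2 fun i => h _
  have h2 := (e₂.symm.contDiff (n := n)).contMDiff.contMDiffAt.comp p h1
  refine h2.congr_of_eventuallyEq (Filter.Eventually.of_forall fun x => ?_)
  exact (e₂.symm_apply_apply (A x)).symm

/-- Contraction of a 2-form with a vector. -/
def contract {V : Type*} [NormedAddCommGroup V] [NormedSpace ℝ V] (A : V [⋀^Fin 2]→L[ℝ] ℝ)
    (x : V) : V →L[ℝ] ℝ :=
  (ContinuousAlternatingMap.ofSubsingleton ℝ V ℝ (0 : Fin 1)).symm (A.curryLeft x)

lemma contract_apply {V : Type*} [NormedAddCommGroup V] [NormedSpace ℝ V]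
    (A : V [⋀^Fin 2]→L[ℝ] ℝ) (x y : V) : contract A x y = A ![x, y] :=
  congrArg A (funext fun i => by fin_cases i <;> rfl)

lemma exists_equiv_of_injective {V : Type*} [NormedAddCommGroup V] [NormedSpace ℝ V]
    [FiniteDimensional ℝ V] {A : V →L[ℝ] V →L[ℝ] ℝ} (hA : ∀ a, (∀ b, A a b = 0) → a = 0) :
    ∃ e : V ≃L[ℝ] (V →L[ℝ] ℝ), (e : V →L[ℝ] V →L[ℝ] ℝ) = A := by
  have hinj : Function.Injective A.toLinearMap := by
    rw [injective_iff_map_eq_zero]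
    exact fun a ha => hA a fun b => by
      have := congrArg (fun B : V →L[ℝ] ℝ => B b) ha
      simpa using this
  have hdim : Module.finrank ℝ V = Module.finrank ℝ (V →L[ℝ] ℝ) := by
    rw [← (LinearMap.toContinuousLinearMap (𝕜 := ℝ) (E := V) (F' := ℝ)).finrank_eq]
    exact (Subspace.dual_finrank_eq (K := ℝ) (V := V)).symm
  refine ⟨(LinearEquiv.ofInjectiveOfFinrankEq A.toLinearMap hinj hdim).toContinuousLinearEquiv, ?_⟩
  ext a b
  rfl

variable [IsManifold (𝓡 4) ∞ M]

namespace LorentzMetric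

variable (g : LorentzMetric M)

lemma eq_zero_of_forall_val_eq_zero (p : M) {u : TangentSpace (𝓡 4) p}
    (h : ∀ w, g.val p u w = 0) : u = 0 := by
  have hη : ∀ i, η i * η i = 1 := by
    intro i; fin_cases i <;> simp [η]
  rw [← (g.frame p).sum_repr u]
  refine Finset.sum_eq_zero fun j _ => ?_
  have h1 := h (g.frame p j)
  rw [← (g.frame p).sum_repr u] at h1
  simp only [map_sum, map_smul, sum_apply, smul_apply,
    g.val_frame, smul_eq_mul, mul_ite, mul_zero, Finset.sum_ite_eq', Finset.mem_univ,
    if_true] at h1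
  have h2 : (g.frame p).repr u j = 0 := by
    linear_combination η j * h1 - (g.frame p).repr u j * hη j
  rw [h2, zero_smul]

/-- The inverse of the tangent trivialization is the differential of the inverse chart, so chart
expressions of forms and trivialized vectors can be combined. -/
lemma inChart_extChartAt {σ : DiffForm 4 M 2} {p₀ p : M}
    (hp : p ∈ (trivializationAt (EuclideanSpace ℝ (Fin 4)) (TangentSpace (𝓡 4) : M → Type _)
      p₀).baseSet) (x y : EuclideanSpace ℝ (Fin 4)) :
    DiffForm.inChart σ p₀ (extChartAt (𝓡 4) p₀ p) ![x, y] =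
      σ p ![(trivializationAt (EuclideanSpace ℝ (Fin 4)) (TangentSpace (𝓡 4) : M → Type _)
        p₀).symmL ℝ p x, (trivializationAt (EuclideanSpace ℝ (Fin 4))
        (TangentSpace (𝓡 4) : M → Type _) p₀).symmL ℝ p y] := by
  have hp' : p ∈ (chartAt (EuclideanSpace ℝ (Fin 4)) p₀).source := hp
  have key : ∀ p', p' = p → ∀ A : EuclideanSpace ℝ (Fin 4) →L[ℝ] EuclideanSpace ℝ (Fin 4),
      ContinuousAlternatingMap.compContinuousLinearMap
        (M' := EuclideanSpace ℝ (Fin 4)) (σ p') A ![x, y] = σ p ![A x, A y] := by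
    intro p' hpp A
    subst hpp
    exact congrArg (σ p') (funext fun i => by fin_cases i <;> rfl)
  rw [TangentBundle.symmL_trivializationAt hp', ModelWithCorners.Boundaryless.range_eq_univ,
    mfderivWithin_univ]
  exact key _ ((extChartAt (𝓡 4) p₀).left_inv (by rwa [extChartAt_source])) _

/-- A vector field whose associated covector field is the contraction of a smooth 2-form with a
smooth vector field is smooth. -/
lemma contMDiff_of_val_eq {σ : DiffForm 4 M 2} (hσ : DiffForm.IsSmooth σ)
    {v X : (p : M) → TangentSpace (𝓡 4) p}
    (hv : ContMDiff (𝓡 4) (𝓡 4).tangent ∞ (fun p ↦ (⟨p, v p⟩ : TangentBundle (𝓡 4) M)))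
    (hX : ∀ p w, g.val p (X p) w = σ p ![w, v p]) :
    ContMDiff (𝓡 4) (𝓡 4).tangent ∞ (fun p ↦ (⟨p, X p⟩ : TangentBundle (𝓡 4) M)) := by
  intro p₀
  let V := EuclideanSpace ℝ (Fin 4)
  set T := trivializationAt V (TangentSpace (𝓡 4) : M → Type _) p₀ with hT
  have hp₀ : p₀ ∈ T.baseSet := FiberBundle.mem_baseSet_trivializationAt' p₀
  have hbase : ∀ᶠ p in 𝓝 p₀, p ∈ T.baseSet := T.open_baseSet.mem_nhds hp₀
  have hv' : ContMDiffAt (𝓡 4) 𝓘(ℝ, V) ∞ (fun p => T.continuousLinearMapAt ℝ p (v p)) p₀ := by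
    refine ((Bundle.contMDiffAt_section (s := v) p₀).1 (hv p₀)).congr_of_eventuallyEq ?_
    filter_upwards [hbase] with p hp
    rw [T.continuousLinearMapAt_apply_of_mem (R := ℝ) hp]
  have hs : ∀ a : V, ContMDiffAt (𝓡 4) ((𝓡 4).prod 𝓘(ℝ, V)) ∞
      (fun p => Bundle.TotalSpace.mk' V p (T.symmL ℝ p a)) p₀ := by
    intro a
    rw [T.contMDiffAt_section_iff hp₀]
    refine (contMDiffAt_const (c := a)).congr_of_eventuallyEq ?_
    filter_upwards [hbase] with p hp
    rw [T.symmL_apply hp]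
    exact congrArg Prod.snd (T.apply_mk_symm hp a)
  let S : M → V →L[ℝ] V := fun p => T.symmL ℝ p
  let gV : M → V →L[ℝ] V →L[ℝ] ℝ := fun p => g.val p
  -- In the trivialization, `X` is the inverse of `G` applied to the covector `G p (Xc p)`. That
  -- covector is smooth because it comes from `σ` and `v`, and inversion is smooth at the invertible
  -- `G p₀`.
  let G : M → V →L[ℝ] V →L[ℝ] ℝ := fun p => (gV p).bilinearComp (S p) (S p)
  have hG : ContMDiffAt (𝓡 4) 𝓘(ℝ, V →L[ℝ] V →L[ℝ] ℝ) ∞ G p₀ := by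
    refine contMDiffAt_clm_of_apply fun a => contMDiffAt_clm_of_apply fun b => ?_
    have h1 := (g.contMDiff p₀).clm_bundle_apply₂ (E₃ := fun _ : M => ℝ) (hs a) (hs b)
    exact (Bundle.contMDiffAt_section (s := fun p => g.val p (T.symmL ℝ p a) (T.symmL ℝ p b)) p₀).1
      h1
  let Xc : M → V := fun p => T.continuousLinearMapAt ℝ p (X p)
  let vc : M → V := fun p => T.continuousLinearMapAt ℝ p (v p)
  have hα : ContMDiffAt (𝓡 4) 𝓘(ℝ, V →L[ℝ] ℝ) ∞ (fun p => G p (Xc p)) p₀ := by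
    refine contMDiffAt_clm_of_apply fun b => ?_
    let β := EuclideanSpace.basisFun (Fin 4) ℝ
    have h1 : ContMDiffAt (𝓡 4) 𝓘(ℝ, V [⋀^Fin 2]→L[ℝ] ℝ) ∞
        (fun p => DiffForm.inChart σ p₀ (extChartAt (𝓡 4) p₀ p)) p₀ := by
      have h2 : ContMDiffAt 𝓘(ℝ, V) 𝓘(ℝ, V [⋀^Fin 2]→L[ℝ] ℝ) ∞ (DiffForm.inChart σ p₀)
          (extChartAt (𝓡 4) p₀ p₀) :=
        ((hσ p₀).contDiffAt (extChartAt_target_mem_nhds p₀)).contMDiffAt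
      exact h2.comp p₀ contMDiffAt_extChartAt
    have h3 : ContMDiffAt (𝓡 4) 𝓘(ℝ, ℝ) ∞ (fun p => ∑ i, vc p i *
        DiffForm.inChart σ p₀ (extChartAt (𝓡 4) p₀ p) ![b, β i]) p₀ := by
      refine contMDiffAt_finsetSum fun i _ => ContMDiffAt.mul ?_ ?_
      · exact (EuclideanSpace.proj (𝕜 := ℝ) i).contDiff.contMDiff.contMDiffAt.comp p₀ hv'
      · exact (ContinuousAlternatingMap.apply ℝ V ℝ ![b, β i]).contDiff.contMDiff.contMDiffAt.comp
          p₀ h1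
    refine h3.congr_of_eventuallyEq ?_
    filter_upwards [hbase] with p hp
    have h4 : G p (Xc p) b = σ p ![S p b, S p (vc p)] := by
      have h5 : S p (Xc p) = X p := T.symmL_continuousLinearMapAt hp (X p)
      have h6 : S p (vc p) = v p := T.symmL_continuousLinearMapAt hp (v p)
      rw [ContinuousLinearMap.bilinearComp_apply, h5, h6]
      exact hX p (S p b)
    simp only [h4, inChart_extChartAt hp]
    -- Expanding in a fixed basis leaves only evaluations of the form on constant vectors.
    have h7 : vc p = ∑ i, vc p i • β i := by
      simpa [β] using (β.sum_repr (vc p)).symm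
    let σV : V [⋀^Fin 2]→L[ℝ] ℝ := σ p
    change σV ![S p b, S p (vc p)] = ∑ i, vc p i * σV ![S p b, S p (β i)]
    conv_lhs => rw [h7]
    simp only [← contract_apply, map_sum, map_smul, smul_eq_mul]
  have hinv : ∀ p ∈ T.baseSet, ∃ e : V ≃L[ℝ] (V →L[ℝ] ℝ), (e : V →L[ℝ] V →L[ℝ] ℝ) = G p := by
    intro p hp
    refine exists_equiv_of_injective fun a ha => ?_
    have h1 : T.symmL ℝ p a = 0 := g.eq_zero_of_forall_val_eq_zero p fun w => by
      have h2 := ha (T.continuousLinearMapAt ℝ p w)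
      have h3 : S p (T.continuousLinearMapAt ℝ p w) = w := T.symmL_continuousLinearMapAt hp w
      rw [ContinuousLinearMap.bilinearComp_apply, h3] at h2
      exact h2
    have h4 := T.continuousLinearMapAt_symmL (R := ℝ) hp a
    rw [h1, map_zero] at h4
    exact h4.symm
  rw [Bundle.contMDiffAt_section]
  obtain ⟨e₀, he₀⟩ := hinv p₀ hp₀
  have hGi : ContMDiffAt (𝓡 4) 𝓘(ℝ, (V →L[ℝ] ℝ) →L[ℝ] V) ∞ (fun p => (G p).inverse) p₀ := by
    have h1 : ContDiffAt ℝ ∞ (ContinuousLinearMap.inverse : (V →L[ℝ] V →L[ℝ] ℝ) → _) (G p₀) :=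
      he₀ ▸ contDiffAt_map_inverse e₀
    exact h1.contMDiffAt.comp p₀ hG
  refine (hGi.clm_apply hα).congr_of_eventuallyEq ?_
  filter_upwards [hbase] with p hp
  obtain ⟨e, he⟩ := hinv p hp
  rw [← he, ContinuousLinearMap.inverse_equiv]
  simp only [ContinuousLinearEquiv.coe_coe, ContinuousLinearEquiv.symm_apply_apply, Xc]
  rw [T.continuousLinearMapAt_apply_of_mem (R := ℝ) hp]

end LorentzMetric
end Smoothness

/-! ### Linear algebra of simple 2-forms in dimension four -/

section LinearAlgebra

variable {V : Type*} [AddCommGroup V] [Module ℝ V]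

/-- Otherwise `a, b, u` extend to a basis, on which a nonzero top form cannot vanish. -/
lemma exists_eq_of_volume_eq_zero (hV : Module.finrank ℝ V = 4) {ε : V [⋀^Fin 4]→ₗ[ℝ] ℝ}
    (hε : ε ≠ 0) {a b u : V} (hab : LinearIndependent ℝ ![a, b])
    (h : ∀ w, ε ![a, b, u, w] = 0) : ∃ r s : ℝ, u = r • a + s • b := by
  by_contra hne
  have : FiniteDimensional ℝ V := Module.finite_of_finrank_pos (by omega)
  have hu : u ∉ Submodule.span ℝ (range ![a, b]) := by
    intro hu
    rw [Matrix.range_cons, Matrix.range_cons, Matrix.range_empty, union_empty,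
      singleton_union, Submodule.mem_span_pair] at hu
    obtain ⟨r, s, hrs⟩ := hu
    exact hne ⟨r, s, hrs.symm⟩
  have h3 : LinearIndependent ℝ (Fin.snoc ![a, b] u : Fin 3 → V) :=
    linearIndependent_finSnoc.2 ⟨hab, hu⟩
  obtain ⟨w, hw⟩ := exists_linearIndependent_snoc_of_lt_finrank h3 (by omega)
  have h4 : (Fin.snoc (Fin.snoc ![a, b] u : Fin 3 → V) w : Fin 4 → V) = ![a, b, u, w] := by
    funext i; fin_cases i <;> rfl
  rw [h4] at hw
  have h5 := (AlternatingMap.map_basis_ne_zero_iff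
    (basisOfLinearIndependentOfCardEqFinrank hw (by simp [hV])) ε).2 hε
  rw [coe_basisOfLinearIndependentOfCardEqFinrank] at h5
  exact h5 (h w)

/-- A functional vanishing on a common kernel is a combination of the functionals defining it;
nondegeneracy carries this back to vectors. -/
lemma exists_eq_of_ker_le {g : V →ₗ[ℝ] V →ₗ[ℝ] ℝ} (hg : ∀ u, (∀ w, g u w = 0) → u = 0)
    {a b v : V} (h : ∀ u, g a u = 0 → g b u = 0 → g v u = 0) :
    ∃ r s : ℝ, v = r • a + s • b := by
  have h1 : g v ∈ Submodule.span ℝ (range ![g a, g b]) := by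
    refine mem_span_of_iInf_ker_le_ker fun u hu => ?_
    rw [Submodule.mem_iInf] at hu
    exact h u (hu 0) (hu 1)
  rw [Matrix.range_cons, Matrix.range_cons, Matrix.range_empty, union_empty,
    singleton_union, Submodule.mem_span_pair] at h1
  obtain ⟨r, s, hrs⟩ := h1
  refine ⟨r, s, sub_eq_zero.1 (hg _ fun w => ?_)⟩
  rw [map_sub, ← hrs]
  simp

lemma finrank_ker_pair (hV : Module.finrank ℝ V = 4) {α β : V →ₗ[ℝ] ℝ} {u w : V}
    (h : α u * β w - α w * β u ≠ 0) :
    Module.finrank ℝ (LinearMap.ker (α.prod β)) = 2 := by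
  have : FiniteDimensional ℝ V := Module.finite_of_finrank_pos (by omega)
  have hsurj : Function.Surjective (α.prod β) := by
    rintro ⟨s, t⟩
    -- Cramer's rule for the system with determinant `α u * β w - α w * β u`.
    refine ⟨((s * β w - t * α w) / (α u * β w - α w * β u)) • u +
      ((t * α u - s * β u) / (α u * β w - α w * β u)) • w, ?_⟩
    refine Prod.ext ?_ ?_
    · change α _ = s
      simp only [map_add, map_smul, smul_eq_mul]
      rw [div_mul_eq_mul_div, div_mul_eq_mul_div, ← add_div, div_eq_iff h]
      ring
    · change β _ = t
      simp only [map_add, map_smul, smul_eq_mul]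
      rw [div_mul_eq_mul_div, div_mul_eq_mul_div, ← add_div, div_eq_iff h]
      ring
  have h1 := (α.prod β).finrank_range_add_finrank_ker
  rw [LinearMap.range_eq_top.2 hsurj, finrank_top, Module.finrank_prod, Module.finrank_self,
    hV] at h1
  omega

lemma finrank_ker_of_ne_zero {n : ℕ} (hV : Module.finrank ℝ V = n + 1) {α : V →ₗ[ℝ] ℝ}
    {u : V} (h : α u ≠ 0) : Module.finrank ℝ (LinearMap.ker α) = n := by
  have : FiniteDimensional ℝ V := Module.finite_of_finrank_pos (by omega)
  have h1 := α.finrank_range_add_finrank_ker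
  rw [LinearMap.range_eq_top.2 (LinearMap.surjective fun h0 => h (by simp [h0])), finrank_top,
    Module.finrank_self, hV] at h1
  omega

/-- The contraction of a volume form with the metric dual of `α ∧ β`. -/
lemma sum_sum_volume_eq {ι : Type*} [Fintype ι] (ε : V [⋀^Fin 4]→ₗ[ℝ] ℝ) (e : ι → V)
    (η x y : ι → ℝ) (u w : V) :
    (1 / 2 : ℝ) * ∑ c, ∑ d, η c * η d * (x c * y d - x d * y c) * ε ![e c, e d, u, w] =
      ε ![∑ c, (η c * x c) • e c, ∑ c, (η c * y c) • e c, u, w] := by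
  let Φ : V →ₗ[ℝ] V →ₗ[ℝ] ℝ := LinearMap.mk₂ ℝ (fun a b => ε ![a, b, u, w])
    (fun a a' b => by simpa using ε.toMultilinearMap.cons_add ![b, u, w] a a')
    (fun r a b => by simpa using ε.toMultilinearMap.cons_smul ![b, u, w] r a)
    (fun a b b' => by
      simpa using (ε.curryLeft a).toMultilinearMap.cons_add ![u, w] b b')
    (fun r a b => by
      simpa using (ε.curryLeft a).toMultilinearMap.cons_smul ![u, w] r b)
  have hΦ : ∀ a b, ε ![a, b, u, w] = Φ a b := fun a b => rfl
  have hsw : ∀ a b, Φ b a = -Φ a b := by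
    intro a b
    rw [← hΦ, ← hΦ, ← ε.map_swap ![a, b, u, w] (i := 0) (j := 1) (by decide)]
    congr 1
    funext i; fin_cases i <;> rfl
  simp only [hΦ, map_sum, LinearMap.sum_apply, map_smul, LinearMap.smul_apply, smul_eq_mul]
  -- Exchanging `c` and `d` and using antisymmetry of `Φ`, the two halves of the sum agree up to
  -- sign; their difference doubles one half, which cancels the factor `1 / 2`.
  have h1 : ∑ c, ∑ d, η c * η d * (x d * y c) * Φ (e c) (e d) =
      -∑ c, ∑ d, η c * η d * (x c * y d) * Φ (e c) (e d) := by
    rw [Finset.sum_comm, ← Finset.sum_neg_distrib]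
    refine Finset.sum_congr rfl fun c _ => ?_
    rw [← Finset.sum_neg_distrib]
    refine Finset.sum_congr rfl fun d _ => ?_
    rw [hsw (e c) (e d)]
    ring
  simp only [mul_sub, sub_mul, Finset.sum_sub_distrib]
  rw [h1]
  have h2 : ∑ c, ∑ d, η c * η d * (x c * y d) * Φ (e c) (e d) =
      ∑ d, η d * y d * ∑ c, η c * x c * Φ (e c) (e d) := by
    rw [Finset.sum_comm]
    refine Finset.sum_congr rfl fun c _ => ?_
    rw [Finset.mul_sum]
    exact Finset.sum_congr rfl fun d _ => by ring
  rw [← h2]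
  ring

end LinearAlgebra

/-! ### Kernels of F and its dual, and transversality to the hypersurface -/

section Spacetime

variable {M : Type*} [TopologicalSpace M] [ChartedSpace (EuclideanSpace ℝ (Fin 4)) M]

lemma DiffForm.IsSmooth.neg {σ : DiffForm 4 M 2} (h : DiffForm.IsSmooth σ) :
    DiffForm.IsSmooth (fun p => -(σ p)) := fun p₀ => (h p₀).neg

section TwoForm

variable (σ : DiffForm 4 M 2) (p : M) (u w x : TangentSpace (𝓡 4) p)

/-- Contraction of a 2-form with a vector, in the first slot. -/
def DiffForm.slot : TangentSpace (𝓡 4) p →ₗ[ℝ] ℝ :=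
  (contract (V := EuclideanSpace ℝ (Fin 4)) (σ p) u).toLinearMap

lemma DiffForm.slot_apply : DiffForm.slot σ p u w = σ p ![u, w] :=
  contract_apply (V := EuclideanSpace ℝ (Fin 4)) (σ p) u w

lemma DiffForm.apply_swap : σ p ![w, u] = -σ p ![u, w] := by
  refine Eq.trans ?_ ((σ p).toAlternatingMap.map_swap ![u, w] (i := 0) (j := 1) (by decide))
  exact congrArg (σ p) (funext fun i => by fin_cases i <;> rfl)

end TwoForm

variable [IsManifold (𝓡 4) ∞ M]

namespace LorentzMetric

variable (g : LorentzMetric M)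

lemma finrank_eq_four (p : M) : Module.finrank ℝ (TangentSpace (𝓡 4) p) = 4 :=
  finrank_tangentSpace (m := 4) p

lemma val_sharp_slot (σ : DiffForm 4 M 2) (p : M) (x w : TangentSpace (𝓡 4) p) :
    g.val p (g.sharp p fun w => σ p ![w, x]) w = σ p ![w, x] := by
  have h := g.val_sharp p (-(DiffForm.slot σ p x)) w
  have h1 : (fun w => σ p ![w, x]) = ⇑(-(DiffForm.slot σ p x)) := by
    funext w
    rw [LinearMap.neg_apply, DiffForm.slot_apply, DiffForm.apply_swap]
  rw [h1, h, ← h1]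

lemma val_electricField (F : DiffForm 4 M 2) (v : (p : M) → TangentSpace (𝓡 4) p) (p : M)
    (w : TangentSpace (𝓡 4) p) : g.val p (g.electricField F v p) w = F p ![w, v p] :=
  g.val_sharp_slot F p (v p) w

lemma val_magneticField (ε : DiffForm 4 M 4) (F : DiffForm 4 M 2)
    (v : (p : M) → TangentSpace (𝓡 4) p) (p : M) (w : TangentSpace (𝓡 4) p) :
    g.val p (g.magneticField ε F v p) w = -(g.hodgeStar ε F p ![w, v p]) :=
  g.val_sharp_slot (fun p => -(g.hodgeStar ε F p)) p (v p) w

variable {g} {ε : DiffForm 4 M 4} {F : DiffForm 4 M 2}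

/-- `F` at `p` is the wedge product of the metric duals of the independent vectors `a` and `b`. -/
structure IsBivectorPair (g : LorentzMetric M) (ε : DiffForm 4 M 4) (F : DiffForm 4 M 2) (p : M)
    (a b : TangentSpace (𝓡 4) p) : Prop where
  linearIndependent : LinearIndependent ℝ ![a, b]
  apply_eq : ∀ u w, F p ![u, w] = g.val p a u * g.val p b w - g.val p a w * g.val p b u
  exists_ne_zero : ∃ u w, F p ![u, w] ≠ 0
  hodgeStar_eq : ∀ u w, g.hodgeStar ε F p ![u, w] = ε p ![a, b, u, w]
  volume_ne_zero : (ε p).toAlternatingMap ≠ 0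

/-- The vectors are the metric duals of the two covectors in the decomposition of `F`. A linear
relation between them would force `F p = 0`, and `sum_sum_volume_eq` collapses the Hodge sum. -/
lemma exists_isBivectorPair (hε : g.IsVolumeForm ε) (hF : g.IsSimpleMaxwellField ε F) (p : M) :
    ∃ a b, IsBivectorPair g ε F p a b := by
  obtain ⟨α, β, hαβ⟩ := hF.isSimple p
  have hne : ∃ u w, F p ![u, w] ≠ 0 := by
    by_contra! h
    refine hF.ne_zero p (ContinuousAlternatingMap.ext fun x => ?_)
    exact (congrArg (F p) (funext fun i => by fin_cases i <;> rfl)).trans (h (x 0) (x 1))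
  have ha : ∀ w, g.val p (g.sharp p α) w = α w := g.val_sharp p α.toLinearMap
  have hb : ∀ w, g.val p (g.sharp p β) w = β w := g.val_sharp p β.toLinearMap
  refine ⟨g.sharp p α, g.sharp p β, ?_, fun u w => ?_, hne, fun u w => ?_, ?_⟩
  · obtain ⟨u, w, huw⟩ := hne
    rw [LinearIndependent.pair_iff]
    intro r s hrs
    have h1 : ∀ x, r * α x + s * β x = 0 := by
      intro x
      have := congrArg (fun y => g.val p y x) hrs
      simpa [ha, hb] using this
    rw [hαβ] at huw
    have hu := h1 u
    have hw := h1 w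
    constructor
    · have h2 : r * (α u * β w - α w * β u) = 0 := by
        linear_combination β w * hu - β u * hw
      exact (mul_eq_zero.1 h2).resolve_right huw
    · have h2 : s * (α u * β w - α w * β u) = 0 := by
        linear_combination α u * hw - α w * hu
      exact (mul_eq_zero.1 h2).resolve_right huw
  · rw [hαβ, ha, ha, hb, hb]
  · rw [g.hodgeStar_apply]
    simp only [hαβ]
    exact sum_sum_volume_eq (ε p).toAlternatingMap (g.frame p) η (fun c => α (g.frame p c))
      (fun c => β (g.frame p c)) u w
  · intro h0
    have h1 : ε p (g.frame p) = 0 := congrArg (fun A => A (g.frame p)) h0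
    rcases hε.normalized p (g.frame p) (g.val_frame p) with h | h <;> rw [h1] at h <;> norm_num at h

namespace IsBivectorPair

variable {p : M} {a b : TangentSpace (𝓡 4) p} (h : IsBivectorPair g ε F p a b)
include h

/-- For `x, y` with `F p ![x, y] ≠ 0`, testing `u` against both gives an invertible system for `g(a,
u)` and `g(b, u)`. -/
lemma apply_eq_zero_iff (u : TangentSpace (𝓡 4) p) :
    (∀ w, F p ![u, w] = 0) ↔ g.val p a u = 0 ∧ g.val p b u = 0 := by
  constructor
  · intro hu
    obtain ⟨x, y, hxy⟩ := h.exists_ne_zero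
    rw [h.apply_eq] at hxy
    have hx := hu x
    have hy := hu y
    rw [h.apply_eq] at hx hy
    constructor
    · have : g.val p a u * (g.val p a x * g.val p b y - g.val p a y * g.val p b x) = 0 := by
        linear_combination g.val p a x * hy - g.val p a y * hx
      exact (mul_eq_zero.1 this).resolve_right hxy
    · have : g.val p b u * (g.val p a x * g.val p b y - g.val p a y * g.val p b x) = 0 := by
        linear_combination g.val p b x * hy - g.val p b y * hx
      exact (mul_eq_zero.1 this).resolve_right hxy
  · rintro ⟨h1, h2⟩ w
    rw [h.apply_eq, h1, h2]
    ring

lemma hodgeStar_eq_zero_iff (u : TangentSpace (𝓡 4) p) :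
    (∀ w, g.hodgeStar ε F p ![u, w] = 0) ↔ ∃ r s : ℝ, u = r • a + s • b := by
  constructor
  · intro hu
    refine exists_eq_of_volume_eq_zero (finrank_eq_four p) h.volume_ne_zero h.linearIndependent
      fun w => ?_
    exact (h.hodgeStar_eq u w).symm.trans (hu w)
  · rintro ⟨r, s, rfl⟩ w
    have h1 : ∀ w, g.hodgeStar ε F p ![a, w] = 0 := fun w => by
      rw [h.hodgeStar_eq]
      exact (ε p).map_eq_zero_of_eq _ (i := 0) (j := 2) rfl (by decide)
    have h2 : ∀ w, g.hodgeStar ε F p ![b, w] = 0 := fun w => by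
      rw [h.hodgeStar_eq]
      exact (ε p).map_eq_zero_of_eq _ (i := 1) (j := 2) rfl (by decide)
    rw [DiffForm.apply_swap, ← DiffForm.slot_apply, map_add, map_smul, map_smul,
      DiffForm.slot_apply, DiffForm.slot_apply, DiffForm.apply_swap, h1, DiffForm.apply_swap _ _ b,
      h2]
    simp

end IsBivectorPair

lemma finrank_tangentSpace_of_isInducedBy (hε : g.IsVolumeForm ε)
    (hF : g.IsSimpleMaxwellField ε F) {𝓕 : Foliation 4 M 2} (h : 𝓕.IsInducedBy F) (p : M) :
    Module.finrank ℝ (𝓕.tangentSpace p) = 2 := by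
  obtain ⟨a, b, hab⟩ := exists_isBivectorPair hε hF p
  obtain ⟨u, w, huw⟩ := hab.exists_ne_zero
  rw [hab.apply_eq] at huw
  have h1 : 𝓕.tangentSpace p =
      LinearMap.ker ((g.val p a).toLinearMap.prod (g.val p b).toLinearMap) := by
    ext x
    rw [h p x, hab.apply_eq_zero_iff, LinearMap.mem_ker]
    exact (Prod.ext_iff (x := (_, _)) (y := ((0 : ℝ), (0 : ℝ)))).symm
  rw [h1]
  exact finrank_ker_pair (finrank_eq_four p) huw

lemma finrank_tangentSpace_of_isInducedBy_hodgeStar (hε : g.IsVolumeForm ε)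
    (hF : g.IsSimpleMaxwellField ε F) {𝓕 : Foliation 4 M 2}
    (h : 𝓕.IsInducedBy (g.hodgeStar ε F)) (p : M) :
    Module.finrank ℝ (𝓕.tangentSpace p) = 2 := by
  obtain ⟨a, b, hab⟩ := exists_isBivectorPair hε hF p
  have h1 : 𝓕.tangentSpace p = Submodule.span ℝ (range ![a, b]) := by
    ext x
    rw [h p x, hab.hodgeStar_eq_zero_iff, Matrix.range_cons, Matrix.range_cons,
      Matrix.range_empty, union_empty, singleton_union, Submodule.mem_span_pair]
    simp only [eq_comm]
  rw [h1, finrank_span_eq_card hab.linearIndependent, Fintype.card_fin]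

variable {N : Type*} [TopologicalSpace N] [ChartedSpace (EuclideanSpace ℝ (Fin 3)) N]
  [IsManifold (𝓡 3) ∞ N] {ι : N → M} {v : (p : M) → TangentSpace (𝓡 4) p}

/-- The tangent space of a hypersurface orthogonal to `v` is the orthogonal complement of `v`. -/
lemma mem_immersedTangentSpace_iff (hv : g.IsObserver v) (hι : g.IsSpacelikeHypersurface ι)
    (hιv : g.IsOrthogonal ι v) (q : N) (w : TangentSpace (𝓡 4) (ι q)) :
    w ∈ immersedTangentSpace 3 ι q ↔ g.val (ι q) (v (ι q)) w = 0 := by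
  have := finiteDimensional_tangentSpace (m := 4) (ι q)
  have hker : Module.finrank ℝ (LinearMap.ker (g.val (ι q) (v (ι q))).toLinearMap) = 3 := by
    refine finrank_ker_of_ne_zero (finrank_eq_four (ι q)) (u := v (ι q)) ?_
    rw [ContinuousLinearMap.coe_coe, hv.unit]
    exact one_ne_zero
  have hR : Module.finrank ℝ (immersedTangentSpace (m := 4) 3 ι q) = 3 := by
    have h1 := LinearMap.finrank_range_of_inj
      (f := (mfderiv (𝓡 3) (𝓡 4) ι q).toLinearMap)
      (mfderiv_injective_of_isImmersion hι.isImmersion q)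
    exact h1.trans (finrank_tangentSpace (m := 3) q)
  have hle : immersedTangentSpace (m := 4) 3 ι q ≤
      LinearMap.ker (g.val (ι q) (v (ι q))).toLinearMap := fun w hw => hιv q w hw
  rw [Submodule.eq_of_le_of_finrank_eq hle (hR.trans hker.symm)]
  exact LinearMap.mem_ker

/-- The submanifold's tangent space is the hyperplane orthogonal to `v`, and a subspace spans
together with a hyperplane iff it is not contained in it. -/
lemma isTransversalAt_iff (hv : g.IsObserver v) (hι : g.IsSpacelikeHypersurface ι)
    (hιv : g.IsOrthogonal ι v) (𝓕 : Foliation 4 M 2) (q : N) :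
    𝓕.IsTransversalAt 3 ι q ↔
      ∃ u ∈ 𝓕.tangentSpace (ι q), g.val (ι q) (v (ι q)) u ≠ 0 := by
  constructor
  · intro h
    by_contra! hall
    have h1 : v (ι q) ∈ 𝓕.tangentSpace (ι q) ⊔ immersedTangentSpace (m := 4) 3 ι q := by
      rw [show _ = _ from h]; exact Submodule.mem_top
    obtain ⟨x, hx, y, hy, hxy⟩ := Submodule.mem_sup.1 h1
    have h2 := hv.unit (ι q)
    nth_rw 2 [← hxy] at h2
    rw [map_add, hall x hx, (mem_immersedTangentSpace_iff hv hι hιv q y).1 hy] at h2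
    norm_num at h2
  · rintro ⟨u, hu, hne⟩
    refine (Submodule.eq_top_iff' ).2 fun x => ?_
    set c : ℝ := g.val (ι q) (v (ι q)) x / g.val (ι q) (v (ι q)) u with hc
    refine Submodule.mem_sup.2 ⟨c • u, Submodule.smul_mem _ _ hu, x - c • u, ?_, by abel⟩
    rw [mem_immersedTangentSpace_iff hv hι hιv, map_sub, map_smul, hc, smul_eq_mul]
    field_simp
    ring

end LorentzMetric
end Spacetime

/-! ### Electric and magnetic fields as intersection fields -/

namespace LorentzMetric

variable {M : Type*} [TopologicalSpace M] [ChartedSpace (EuclideanSpace ℝ (Fin 4)) M]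
  [IsManifold (𝓡 4) ∞ M] {g : LorentzMetric M} {ε : DiffForm 4 M 4} {F : DiffForm 4 M 2}
  {N : Type*} [TopologicalSpace N] [ChartedSpace (EuclideanSpace ℝ (Fin 3)) N]
  [IsManifold (𝓡 3) ∞ N] {ι : N → M} {v : (p : M) → TangentSpace (𝓡 4) p} {𝓕 : Foliation 4 M 2}

/-- As `σ(v, v) = 0`, the field `X` is orthogonal to `v`, hence tangent to the hypersurface; `Y`
consists of its pointwise preimages. -/
lemma exists_isIntersectionField_of_orthogonal (hv : g.IsObserver v)
    (hι : g.IsSpacelikeHypersurface ι) (hιv : g.IsOrthogonal ι v)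
    {σ : DiffForm 4 M 2} (hσ : DiffForm.IsSmooth σ) {X : (p : M) → TangentSpace (𝓡 4) p}
    (hX : ∀ p w, g.val p (X p) w = σ p ![w, v p])
    (hdim : ∀ p, Module.finrank ℝ (𝓕.tangentSpace p) = 2)
    (hmem : ∀ p, X p ∈ 𝓕.tangentSpace p)
    (hne : ∀ p, X p ≠ 0 ↔ ∃ u ∈ 𝓕.tangentSpace p, g.val p (v p) u ≠ 0) :
    ∃ Y : (q : N) → TangentSpace (𝓡 3) q, IsIntersectionField 𝓕 ι X Y := by
  have hR : ∀ q, ∃ y : TangentSpace (𝓡 3) q, mfderiv (𝓡 3) (𝓡 4) ι q y = X (ι q) := by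
    intro q
    have h1 : X (ι q) ∈ immersedTangentSpace 3 ι q := by
      rw [mem_immersedTangentSpace_iff hv hι hιv, g.symm, hX]
      exact (σ (ι q)).map_eq_zero_of_eq _ (i := 0) (j := 1) rfl (by decide)
    exact h1
  choose Y hY using hR
  exact ⟨Y, hι.isImmersion, (contMDiff_of_val_eq g hσ hv.contMDiff hX).of_le ENat.LEInfty.out, hY,
    fun q => hmem (ι q), fun q => (hne _).trans (isTransversalAt_iff hv hι hιv 𝓕 q).symm, hdim,
    by norm_num⟩

lemma electricField_eq {p : M} {a b : TangentSpace (𝓡 4) p} (hab : IsBivectorPair g ε F p a b) :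
    g.electricField F v p = g.val p b (v p) • a + (-g.val p a (v p)) • b := by
  refine sub_eq_zero.1 (g.eq_zero_of_forall_val_eq_zero p fun w => ?_)
  rw [map_sub, sub_apply, g.val_electricField, hab.apply_eq]
  simp only [map_add, map_smul, add_apply, smul_apply, smul_eq_mul]
  ring

variable (hε : g.IsVolumeForm ε) (hF : g.IsSimpleMaxwellField ε F) (p : M)
include hε hF

/-- Since $\star F$ annihilates `a` and `b`, $g(B,a)=-\star F(a,v)=0$, and likewise for `b`. -/
lemma magneticField_mem (h : 𝓕.IsInducedBy F) : g.magneticField ε F v p ∈ 𝓕.tangentSpace p := by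
  obtain ⟨a, b, hab⟩ := exists_isBivectorPair hε hF p
  rw [h, hab.apply_eq_zero_iff, g.symm p a, g.symm p b, g.val_magneticField, g.val_magneticField,
    (hab.hodgeStar_eq_zero_iff a).2 ⟨1, 0, by simp⟩, (hab.hodgeStar_eq_zero_iff b).2 ⟨0, 1, by simp⟩]
  simp

/-- The field vanishes iff `v` lies in the span of `a` and `b`, which is the double orthogonal
complement, so iff `v` is orthogonal to the kernel of `F`. -/
lemma magneticField_ne_zero_iff (h : 𝓕.IsInducedBy F) :
    g.magneticField ε F v p ≠ 0 ↔ ∃ u ∈ 𝓕.tangentSpace p, g.val p (v p) u ≠ 0 := by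
  obtain ⟨a, b, hab⟩ := exists_isBivectorPair hε hF p
  have hB : g.magneticField ε F v p = 0 ↔ ∃ r s : ℝ, v p = r • a + s • b := by
    rw [← hab.hodgeStar_eq_zero_iff]
    constructor
    · intro h0 w
      have h1 := g.val_magneticField ε F v p w
      rw [h0, map_zero, zero_apply, zero_eq_neg] at h1
      rw [DiffForm.apply_swap, h1, neg_zero]
    · intro h0
      refine g.eq_zero_of_forall_val_eq_zero p fun w => ?_
      rw [g.val_magneticField, DiffForm.apply_swap, h0, neg_zero, neg_zero]
  rw [← not_iff_not, not_not, hB]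
  simp only [h p, hab.apply_eq_zero_iff, not_exists, not_and, not_not]
  constructor
  · rintro ⟨r, s, hrs⟩ u ⟨h1, h2⟩
    rw [hrs]
    simp [h1, h2]
  · intro h0
    let G : TangentSpace (𝓡 4) p →ₗ[ℝ] TangentSpace (𝓡 4) p →ₗ[ℝ] ℝ :=
      LinearMap.mk₂ ℝ (fun u w => g.val p u w) (by simp) (by simp) (by simp) (by simp)
    exact exists_eq_of_ker_le (g := G) (fun u hu => g.eq_zero_of_forall_val_eq_zero p hu)
      fun u h1 h2 => h0 u ⟨h1, h2⟩

lemma electricField_mem (h : 𝓕.IsInducedBy (g.hodgeStar ε F)) :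
    g.electricField F v p ∈ 𝓕.tangentSpace p := by
  obtain ⟨a, b, hab⟩ := exists_isBivectorPair hε hF p
  rw [h, hab.hodgeStar_eq_zero_iff]
  exact ⟨_, _, electricField_eq hab⟩

/-- The coefficients of the field in the independent pair `a, b` are, up to sign, `g(b, v)` and
`g(a, v)`; both vanish iff `v` is orthogonal to the span. -/
lemma electricField_ne_zero_iff (h : 𝓕.IsInducedBy (g.hodgeStar ε F)) :
    g.electricField F v p ≠ 0 ↔ ∃ u ∈ 𝓕.tangentSpace p, g.val p (v p) u ≠ 0 := by
  obtain ⟨a, b, hab⟩ := exists_isBivectorPair hε hF p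
  rw [← not_iff_not, not_not, electricField_eq hab]
  simp only [h p, hab.hodgeStar_eq_zero_iff, not_exists, not_and, not_not]
  constructor
  · rintro h0 u ⟨r, s, rfl⟩
    obtain ⟨h1, h2⟩ := LinearIndependent.pair_iff.1 hab.linearIndependent _ _ h0
    rw [map_add, map_smul, map_smul, g.symm, g.symm p _ b, h1, neg_eq_zero.1 h2]
    simp
  · intro h0
    rw [g.symm p b, g.symm p a, h0 a ⟨1, 0, by simp⟩, h0 b ⟨0, 1, by simp⟩]
    simp

end LorentzMetric

end FieldSheets

end

theorem theorem1 {M : Type*} [TopologicalSpace M] [T2Space M] [SecondCountableTopology M]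
    [ChartedSpace (EuclideanSpace ℝ (Fin 4)) M] [IsManifold (𝓡 4) ∞ M]
    (g : FieldSheets.LorentzMetric M)
    (ε : FieldSheets.DiffForm 4 M 4) (hε : g.IsVolumeForm ε)
    (F : FieldSheets.DiffForm 4 M 2) (hF : g.IsSimpleMaxwellField ε F)
    (𝓕₁ 𝓕₂ : FieldSheets.Foliation 4 M 2)
    (h𝓕₁ : 𝓕₁.IsInducedBy F) (h𝓕₂ : 𝓕₂.IsInducedBy (g.hodgeStar ε F))
    (v : (p : M) → TangentSpace (𝓡 4) p) (hv : g.IsObserver v) (hv' : g.IsGaussian v)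
    {N : Type*} [TopologicalSpace N] [ChartedSpace (EuclideanSpace ℝ (Fin 3)) N]
    [IsManifold (𝓡 3) ∞ N]
    (ι : N → M) (hι : g.IsSpacelikeHypersurface ι) (hιv : g.IsOrthogonal ι v) :
    {C : Set N | FieldSheets.IsLineOfForce (g.magneticField ε F v) ι C} =
        𝓕₁.transversalIntersection 3 ι ∧
      {C : Set N | FieldSheets.IsLineOfForce (g.electricField F v) ι C} =
        𝓕₂.transversalIntersection 3 ι ∧
      (∀ q : N, (∃ C, FieldSheets.IsLineOfForce (g.magneticField ε F v) ι C ∧ q ∈ C) ↔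
        𝓕₁.IsTransversalAt 3 ι q) ∧
      (∀ q : N, (∃ C, FieldSheets.IsLineOfForce (g.electricField F v) ι C ∧ q ∈ C) ↔
        𝓕₂.IsTransversalAt 3 ι q) := by
  -- The Hausdorff property, needed for uniqueness of integral curves in `N`, is inherited through
  -- the injective continuous `ι`.
  have : T2Space N := T2Space.of_injective_continuous hι.injective hι.isImmersion.contMDiff.continuous
  obtain ⟨Y₁, h₁⟩ := FieldSheets.LorentzMetric.exists_isIntersectionField_of_orthogonal hv hι hιv
    hF.isClosed_hodgeStar.1.neg (g.val_magneticField ε F v)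
    (FieldSheets.LorentzMetric.finrank_tangentSpace_of_isInducedBy hε hF h𝓕₁)
    (fun p => FieldSheets.LorentzMetric.magneticField_mem hε hF p h𝓕₁)
    (fun p => FieldSheets.LorentzMetric.magneticField_ne_zero_iff hε hF p h𝓕₁)
  obtain ⟨Y₂, h₂⟩ := FieldSheets.LorentzMetric.exists_isIntersectionField_of_orthogonal hv hι hιv
    hF.isClosed.1 (g.val_electricField F v)
    (FieldSheets.LorentzMetric.finrank_tangentSpace_of_isInducedBy_hodgeStar hε hF h𝓕₂)
    (fun p => FieldSheets.LorentzMetric.electricField_mem hε hF p h𝓕₂)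
    (fun p => FieldSheets.LorentzMetric.electricField_ne_zero_iff hε hF p h𝓕₂)
  exact ⟨h₁.setOf_isLineOfForce, h₂.setOf_isLineOfForce, h₁.exists_isLineOfForce_iff,
    h₂.exists_isLineOfForce_iff⟩
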